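/- Let $D\subset\mathbb R^4$ be a connected open set, with coordinates $(x_1,x_2,x_3,x_4)$, such that for all fixed $(x_3,x_4)$ the slice $\{(x_1,x_2):(x_1,\dots,x_4)\in D\}$ is connected (possibly empty), and let $D'\subset\mathbb R^2$ be the image of $D$ under $(x_1,\dots,x_4)\mapsto(x_3,x_4)$. Let $a,b,c:D\to\mathbb R$ be smooth and let $g$ be the Walker metric $$g=\begin{pmatrix}0&0&1&0\\0&0&0&1\\1&0&a&c\\0&1&c&b\end{pmatrix}$$ on $D$, of signature $(++--)$, oriented by $(\partial_1,\partial_2,\partial_3,\partial_4)$. Subscripts on functions denote partial derivatives. Conventions. $R(X,Y)=\nabla_{[X,Y]}-[\nabla_X,\nabla_Y]$ is the curvature, $R(X,Y,Z,T)=g(R(X,Y)Z,T)$, $\rho(X,Y)=\operatorname{trace}\{U\mapsto R(X,U)Y\}$ is the Ricci tensor, $\tau$ the scalar curvature, $W$ the Weyl tensor (as a $(0,4)$ tensor with the same sign convention as $R$), and $W^\pm=\frac12(W\pm{*W})$; $g$ is self-dual if $W^-=0$. The Jacobi operator of $X$ is $R_X:Y\mapsto R(X,Y)X$ on the tangent space.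 $g$ is pointwise Osserman if at each point the eigenvalues of $R_X$ (complex, with multiplicity) are the same for all $X$ with $g(X,X)=1$ and the same for all $X$ with $g(X,X)=-1$. $g$ is Jordan-Osserman on an open set if the Jordan normal form of $R_X$ is the same for all $X$ with $g(X,X)=1$ at all points of this set, and likewise for $g(X,X)=-1$. Put $$e_1=\tfrac12(1-a)\partial_1+\partial_3,\quad e_2=-c\,\partial_1+\tfrac12(1-b)\partial_2+\partial_4,\quad e_3=-\tfrac12(1+a)\partial_1+\partial_3,\quad e_4=-c\,\partial_1-\tfrac12(1+b)\partial_2+\partial_4$$ (an oriented orthonormal frame with $e_1,e_2$ spacelike), $E_1^+=\frac{1}{\sqrt2}(e_1\wedge e_2+e_3\wedge e_4)$, $E_2^+=\frac1{\sqrt2}(e_1\wedge e_3+e_2\wedge e_4)$, and $W^+_{ij}=W(E_i^+,E_j^+)$, where $W(u\wedge v,w\wedge z)=W(u,v,w,z)$. Explicitly, $$\begin{aligned} W^+_{11}=\tfrac1{12}\big(&6ca_1b_2-6a_1b_3-6ba_1c_2+12a_1c_4-6ca_2b_1+6a_2b_4+6ba_2c_1+6a_3b_1-6a_4b_2-12a_4c_1+6ab_1c_2\\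 &-6ab_2c_1+12b_2c_3-12b_3c_2-a_{11}-12c^2a_{11}-12bca_{12}+24ca_{14}-3b^2a_{22}+12ba_{24}-12a_{44}\\ &-3a^2b_{11}+12ab_{13}-b_{22}-12b_{33}+12acc_{11}-2c_{12}+6abc_{12}-24cc_{13}-12ac_{14}-12bc_{23}+24c_{34}\big),\\ W^+_{12}=\tfrac14\big(&-2ca_{11}-ba_{12}+2a_{14}+ab_{12}-2b_{23}+ac_{11}-2cc_{12}-2c_{13}-bc_{22}+2c_{24}\big). \end{aligned}$$ **Theorem.** The Walker metric $g$ is pointwise Osserman and self-dual if and only if one of the following holds. (i) The scalar curvature $\tau$ is a nonzero constant and there are smooth functions $P,Q,S,T,U,V$ of $(x_3,x_4)$ on $D'$ with $$\begin{aligned} a&=x_1^2\tfrac\tau6+x_1P+x_2Q+\tfrac6\tau\{Q(T-U)+V(P-V)-2(Q_4-V_3)\},\\ b&=x_2^2\tfrac\tau6+x_1S+x_2T+\tfrac6\tau\{S(P-V)+U(T-U)-2(S_3-U_4)\},\\ c&=x_1x_2\tfrac\tau6+x_1U+x_2V+\tfrac6\tau\{-QS+UV+T_3-U_3+P_4-V_4\}.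 \end{aligned}$$ (ii) The scalar curvature vanishes and there are smooth functions $P,Q,S,T,U,V,\xi,\eta,\gamma$ of $(x_3,x_4)$ on $D'$ with $$a=x_1P+x_2Q+\xi,\qquad b=x_1S+x_2T+\eta,\qquad c=x_1U+x_2V+\gamma,$$ $$2(Q_4-V_3)=Q(T-U)+V(P-V),\quad 2(S_3-U_4)=S(P-V)+U(T-U),\quad T_3-U_3+P_4-V_4=QS-UV.$$ In case (i), let $X$ be a unit vector at a point $p\in D$, $g(X,X)=\varepsilon\in\{1,-1\}$. The eigenvalues of $R_X$, with multiplicity, are $\{0,\varepsilon\frac\tau6,\varepsilon\frac\tau{24},\varepsilon\frac\tau{24}\}$. $R_X$ is diagonalizable over $\mathbb R$ if and only if $$\tau^2+12\tau W^+_{11}+48(W^+_{12})^2=0\qquad(\star)$$ at $p$; otherwise $\varepsilon\frac\tau{24}$ is a double root of the minimal polynomial of $R_X$. The set where $(\star)$ fails is open, and $g$ is Jordan-Osserman on it. In case (ii), let $X$ be a unit vector, $g(X,X)=\pm1$, at a point $p\in D$. All eigenvalues of $R_X$ are zero, and the following hold. (ii.1) $R_X=0$ if and only if $T_3+U_3-P_4-V_4=0$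 and $W^+_{11}=0$ at $p$. (ii.2) $R_X$ is two-step nilpotent ($R_X\neq0=R_X^2$) if and only if $T_3+U_3-P_4-V_4=0$ and $W^+_{11}\ne0$ at $p$. (ii.3) $R_X$ is three-step nilpotent ($R_X^2\neq0=R_X^3$) if and only if $T_3+U_3-P_4-V_4\neq0$ at $p$. -/

import Mathlib

open scoped ContDiff

noncomputable section

namespace Walker

/-! ### Pseudo-Riemannian geometry in coordinates on open subsets of `ℝ⁴`

A metric is given by its matrix of components; coordinates `x₁, …, x₄` have indices `0, …, 3`. -/

/-- A field of `4 × 4` matrices: the components of a metric in the coordinates of `ℝ⁴`. -/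
abbrev MetricField := (Fin 4 → ℝ) → Matrix (Fin 4) (Fin 4) ℝ

/-- Partial derivative `∂ᵢ f`. -/
def pd (i : Fin 4) (f : (Fin 4 → ℝ) → ℝ) (x : Fin 4 → ℝ) : ℝ :=
  fderiv ℝ f x (Pi.single i 1)

/-- Christoffel symbols of the Levi-Civita connection: `∇_{∂ᵢ} ∂ⱼ = ∑ₖ Γᵏᵢⱼ ∂ₖ`. -/
def christoffel (g : MetricField) (k i j : Fin 4) (x : Fin 4 → ℝ) : ℝ :=
  (1 / 2) * ∑ l, (g x)⁻¹ k l *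
    (pd i (fun y => g y j l) x + pd j (fun y => g y i l) x - pd l (fun y => g y i j) x)

/-- Components of the curvature `R(X, Y) = ∇_{[X,Y]} - [∇_X, ∇_Y]`:
`R(∂ᵢ, ∂ⱼ) ∂ₖ = ∑ₗ (curv g i j k l) ∂ₗ`. -/
def curv (g : MetricField) (i j k l : Fin 4) (x : Fin 4 → ℝ) : ℝ :=
  -(pd i (christoffel g l j k) x - pd j (christoffel g l i k) x
    + ∑ m, (christoffel g m j k x * christoffel g l i m x
      - christoffel g m i k x * christoffel g l j m x))

/-- `R(∂ᵢ, ∂ⱼ, ∂ₖ, ∂ₗ) = g(R(∂ᵢ, ∂ⱼ) ∂ₖ, ∂ₗ)`. -/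
def riem (g : MetricField) (i j k l : Fin 4) (x : Fin 4 → ℝ) : ℝ :=
  ∑ m, curv g i j k m x * g x m l

/-- Ricci tensor `ρ(X, Y) = trace (U ↦ R(X, U) Y)`. -/
def ricci (g : MetricField) (i j : Fin 4) (x : Fin 4 → ℝ) : ℝ :=
  ∑ u, curv g i u j u x

/-- Scalar curvature `τ`. -/
def scal (g : MetricField) (x : Fin 4 → ℝ) : ℝ :=
  ∑ i, ∑ j, (g x)⁻¹ i j * ricci g i j x

/-- Weyl conformal curvature tensor (in dimension four). -/
def weyl (g : MetricField) (i j k l : Fin 4) (x : Fin 4 → ℝ) : ℝ :=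
  riem g i j k l x
    + scal g x / 6 * (g x i k * g x j l - g x j k * g x i l)
    - (1 / 2) * (ricci g i k x * g x j l - ricci g j k x * g x i l
      + ricci g j l x * g x i k - ricci g i l x * g x j k)

/-- Volume form of the metric for the orientation in which `(∂₁, ∂₂, ∂₃, ∂₄)` is positive. -/
def vol (g : MetricField) (i j k l : Fin 4) (x : Fin 4 → ℝ) : ℝ :=
  Real.sqrt |(g x).det| *
    Matrix.det (Matrix.of ![Pi.single i (1 : ℝ), Pi.single j 1, Pi.single k 1, Pi.single l 1])

/-- `∗W`: the Hodge star of the metric applied to the first pair of indices of the Weyl tensor. -/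
def starWeyl (g : MetricField) (i j k l : Fin 4) (x : Fin 4 → ℝ) : ℝ :=
  (1 / 2) * ∑ m, ∑ n, ∑ r, ∑ s,
    vol g i j m n x * (g x)⁻¹ m r * (g x)⁻¹ n s * weyl g r s k l x

/-- The anti-self-dual Weyl tensor `W⁻ = ½ (W - ∗W)`. -/
def weylMinus (g : MetricField) (i j k l : Fin 4) (x : Fin 4 → ℝ) : ℝ :=
  (1 / 2) * (weyl g i j k l x - starWeyl g i j k l x)

/-- A metric is self-dual on `D` if `W⁻ = 0` there. -/
def IsSelfDual (g : MetricField) (D : Set (Fin 4 → ℝ)) : Prop :=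
  ∀ x ∈ D, ∀ i j k l, weylMinus g i j k l x = 0

/-- The Weyl tensor evaluated on a pair of bivectors (antisymmetric matrices), so that
`W(u ∧ v, w ∧ z) = W(u, v, w, z)`. -/
def weylBivector (g : MetricField) (A B : Matrix (Fin 4) (Fin 4) ℝ) (x : Fin 4 → ℝ) : ℝ :=
  (1 / 4) * ∑ i, ∑ j, ∑ k, ∑ l, A i j * B k l * weyl g i j k l x

/-- The bivector `u ∧ v = u ⊗ v - v ⊗ u`. -/
def wedge (u v : Fin 4 → ℝ) : Matrix (Fin 4) (Fin 4) ℝ :=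
  Matrix.of fun i j => u i * v j - u j * v i

/-- The value `g(X, Y)` at the point `x`. -/
def inner (g : MetricField) (x X Y : Fin 4 → ℝ) : ℝ :=
  ∑ i, ∑ j, X i * g x i j * Y j

/-- The matrix, in the coordinate basis, of the Jacobi operator `R_X : Y ↦ R(X, Y) X` at `x`. -/
def jacobi (g : MetricField) (x X : Fin 4 → ℝ) : Matrix (Fin 4) (Fin 4) ℝ :=
  Matrix.of fun l j => ∑ i, ∑ k, X i * X k * curv g i j k l x

/-- Pointwise Osserman: at each point the eigenvalues of the Jacobi operators (complex, counted
with multiplicity, i.e. the characteristic polynomial) are constant on the pseudo-sphere of unit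
spacelike vectors (`ε = 1`) and on that of unit timelike vectors (`ε = -1`). -/
def IsPointwiseOsserman (g : MetricField) (D : Set (Fin 4 → ℝ)) : Prop :=
  ∀ x ∈ D, ∀ ε : ℝ, (ε = 1 ∨ ε = -1) → ∀ X Y : Fin 4 → ℝ,
    inner g x X X = ε → inner g x Y Y = ε →
      (jacobi g x X).charpoly = (jacobi g x Y).charpoly

/-- Jordan-Osserman on `D`: the Jordan normal form of the Jacobi operators (i.e. their similarity
class) is constant on each of the bundles of unit spacelike and of unit timelike vectors. -/
def IsJordanOsserman (g : MetricField) (D : Set (Fin 4 → ℝ)) : Prop :=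
  ∀ x ∈ D, ∀ y ∈ D, ∀ ε : ℝ, (ε = 1 ∨ ε = -1) → ∀ X Y : Fin 4 → ℝ,
    inner g x X X = ε → inner g y Y Y = ε →
      IsConj (jacobi g x X) (jacobi g y Y)

/-- A real matrix is diagonalizable if it is similar over `ℝ` to a diagonal matrix. -/
def IsDiagonalizable (A : Matrix (Fin 4) (Fin 4) ℝ) : Prop :=
  ∃ d : Fin 4 → ℝ, IsConj A (Matrix.diagonal d)

/-! ### Walker metrics -/

/-- The Walker metric defined by the functions `a`, `b`, `c`. -/
def walker (a b c : (Fin 4 → ℝ) → ℝ) : MetricField := fun x =>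
  !![0, 0, 1, 0;
     0, 0, 0, 1;
     1, 0, a x, c x;
     0, 1, c x, b x]

/-- The orthonormal frame `e₁, …, e₄` (with `e₁, e₂` spacelike and `e₃, e₄` timelike). -/
def frame (a b c : (Fin 4 → ℝ) → ℝ) (x : Fin 4 → ℝ) : Fin 4 → Fin 4 → ℝ :=
  ![![(1 - a x) / 2, 0, 1, 0],
    ![-c x, (1 - b x) / 2, 0, 1],
    ![-(1 + a x) / 2, 0, 1, 0],
    ![-c x, -(1 + b x) / 2, 0, 1]]

/-- The basis `E₁⁺, E₂⁺, E₃⁺` of the self-dual bivectors. -/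
def sdBasis (a b c : (Fin 4 → ℝ) → ℝ) (x : Fin 4 → ℝ) : Fin 3 → Matrix (Fin 4) (Fin 4) ℝ :=
  let e := frame a b c x
  ![(Real.sqrt 2)⁻¹ • (wedge (e 0) (e 1) + wedge (e 2) (e 3)),
    (Real.sqrt 2)⁻¹ • (wedge (e 0) (e 2) + wedge (e 1) (e 3)),
    (Real.sqrt 2)⁻¹ • (wedge (e 0) (e 3) - wedge (e 1) (e 2))]

/-- The components `W⁺ᵢⱼ = W(Eᵢ⁺, Eⱼ⁺)`; thus `W⁺₁₁` is `wPlus a b c 0 0`. -/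
def wPlus (a b c : (Fin 4 → ℝ) → ℝ) (i j : Fin 3) (x : Fin 4 → ℝ) : ℝ :=
  weylBivector (walker a b c) (sdBasis a b c x i) (sdBasis a b c x j) x

/-- The coordinate expression of `W⁺₁₁`. -/
def w11Expr (a b c : (Fin 4 → ℝ) → ℝ) (x : Fin 4 → ℝ) : ℝ :=
  (1 / 12) * (
    6 * c x * pd 0 a x * pd 1 b x - 6 * pd 0 a x * pd 2 b x - 6 * b x * pd 0 a x * pd 1 c x
    + 12 * pd 0 a x * pd 3 c x - 6 * c x * pd 1 a x * pd 0 b x + 6 * pd 1 a x * pd 3 b x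
    + 6 * b x * pd 1 a x * pd 0 c x
    + 6 * pd 2 a x * pd 0 b x - 6 * pd 3 a x * pd 1 b x - 12 * pd 3 a x * pd 0 c x
    + 6 * a x * pd 0 b x * pd 1 c x - 6 * a x * pd 1 b x * pd 0 c x
    + 12 * pd 1 b x * pd 2 c x - 12 * pd 2 b x * pd 1 c x
    - pd 0 (pd 0 a) x - 12 * c x ^ 2 * pd 0 (pd 0 a) x - 12 * b x * c x * pd 0 (pd 1 a) x
    + 24 * c x * pd 0 (pd 3 a) x - 3 * b x ^ 2 * pd 1 (pd 1 a) x + 12 * b x * pd 1 (pd 3 a) x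
    - 12 * pd 3 (pd 3 a) x
    - 3 * a x ^ 2 * pd 0 (pd 0 b) x + 12 * a x * pd 0 (pd 2 b) x - pd 1 (pd 1 b) x
    - 12 * pd 2 (pd 2 b) x + 12 * a x * c x * pd 0 (pd 0 c) x - 2 * pd 0 (pd 1 c) x
    + 6 * a x * b x * pd 0 (pd 1 c) x
    - 24 * c x * pd 0 (pd 2 c) x - 12 * a x * pd 0 (pd 3 c) x - 12 * b x * pd 1 (pd 2 c) x
    + 24 * pd 2 (pd 3 c) x)

/-- The coordinate expression of `W⁺₁₂`. -/
def w12Expr (a b c : (Fin 4 → ℝ) → ℝ) (x : Fin 4 → ℝ) : ℝ :=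
  (1 / 4) * (
    -2 * c x * pd 0 (pd 0 a) x - b x * pd 0 (pd 1 a) x + 2 * pd 0 (pd 3 a) x
    + a x * pd 0 (pd 1 b) x - 2 * pd 1 (pd 2 b) x + a x * pd 0 (pd 0 c) x
    - 2 * c x * pd 0 (pd 1 c) x - 2 * pd 0 (pd 2 c) x
    - b x * pd 1 (pd 1 c) x + 2 * pd 1 (pd 3 c) x)

/-- The projection `(x₁, x₂, x₃, x₄) ↦ (x₃, x₄)`. -/
def proj (x : Fin 4 → ℝ) : ℝ × ℝ := (x 2, x 3)

/-- `∂f/∂x₃` of a function of `(x₃, x₄)`. -/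
def d3 (f : ℝ × ℝ → ℝ) (y : ℝ × ℝ) : ℝ := fderiv ℝ f y (1, 0)

/-- `∂f/∂x₄` of a function of `(x₃, x₄)`. -/
def d4 (f : ℝ × ℝ → ℝ) (y : ℝ × ℝ) : ℝ := fderiv ℝ f y (0, 1)

/-- The functions `P, Q, S, T, U, V` of `(x₃, x₄)` are smooth on the projection of `D`. -/
def SmoothCoeffs (D : Set (Fin 4 → ℝ)) (P Q S T U V : ℝ × ℝ → ℝ) : Prop :=
  ContDiffOn ℝ ∞ P (proj '' D) ∧ ContDiffOn ℝ ∞ Q (proj '' D) ∧ ContDiffOn ℝ ∞ S (proj '' D) ∧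
  ContDiffOn ℝ ∞ T (proj '' D) ∧ ContDiffOn ℝ ∞ U (proj '' D) ∧ ContDiffOn ℝ ∞ V (proj '' D)

/-- Case (i): the scalar curvature is the nonzero constant `τ`, and `a`, `b`, `c` are quadratic
in `(x₁, x₂)` of the displayed form. -/
def FormNonzero (D : Set (Fin 4 → ℝ)) (a b c : (Fin 4 → ℝ) → ℝ) (τ : ℝ)
    (P Q S T U V : ℝ × ℝ → ℝ) : Prop :=
  τ ≠ 0 ∧ (∀ x ∈ D, scal (walker a b c) x = τ) ∧ SmoothCoeffs D P Q S T U V ∧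
  ∀ x ∈ D, ∀ y : ℝ × ℝ, y = proj x →
    a x = x 0 ^ 2 * (τ / 6) + x 0 * P y + x 1 * Q y
      + 6 / τ * (Q y * (T y - U y) + V y * (P y - V y) - 2 * (d4 Q y - d3 V y)) ∧
    b x = x 1 ^ 2 * (τ / 6) + x 0 * S y + x 1 * T y
      + 6 / τ * (S y * (P y - V y) + U y * (T y - U y) - 2 * (d3 S y - d4 U y)) ∧
    c x = x 0 * x 1 * (τ / 6) + x 0 * U y + x 1 * V y
      + 6 / τ * (-(Q y * S y) + U y * V y + d3 T y - d3 U y + d4 P y - d4 V y)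

/-- Case (ii): the scalar curvature vanishes, and `a`, `b`, `c` are affine in `(x₁, x₂)` with
coefficients satisfying the displayed system of first-order equations. -/
def FormZero (D : Set (Fin 4 → ℝ)) (a b c : (Fin 4 → ℝ) → ℝ)
    (P Q S T U V ξ η γ : ℝ × ℝ → ℝ) : Prop :=
  (∀ x ∈ D, scal (walker a b c) x = 0) ∧ SmoothCoeffs D P Q S T U V ∧
  ContDiffOn ℝ ∞ ξ (proj '' D) ∧ ContDiffOn ℝ ∞ η (proj '' D) ∧ ContDiffOn ℝ ∞ γ (proj '' D) ∧
  (∀ x ∈ D, ∀ y : ℝ × ℝ, y = proj x →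
    a x = x 0 * P y + x 1 * Q y + ξ y ∧
    b x = x 0 * S y + x 1 * T y + η y ∧
    c x = x 0 * U y + x 1 * V y + γ y) ∧
  (∀ y ∈ proj '' D,
    2 * (d4 Q y - d3 V y) = Q y * (T y - U y) + V y * (P y - V y) ∧
    2 * (d3 S y - d4 U y) = S y * (P y - V y) + U y * (T y - U y) ∧
    d3 T y - d3 U y + d4 P y - d4 V y = Q y * S y - U y * V y)

/-- The left-hand side `τ² + 12 τ W⁺₁₁ + 48 (W⁺₁₂)²` of the diagonalizability condition. -/
def diagExpr (a b c : (Fin 4 → ℝ) → ℝ) (τ : ℝ) (x : Fin 4 → ℝ) : ℝ :=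
  τ ^ 2 + 12 * τ * wPlus a b c 0 0 x + 48 * wPlus a b c 0 1 x ^ 2

end Walker

end

/-!
Two-dimensional null distributions parallel along a metric of signature `(++--)` make its
curvature very degenerate. For a Walker metric the vectors `∂₁`, `∂₂` span such a distribution,
hence most components of the curvature vanish or are linear in the second derivatives of `a`, `b`,
`c` (`riem_walker_components`), the anti-self-dual Weyl tensor is determined by five linear
combinations of their second derivatives in `(x₁, x₂)` (`SelfDualEqs`), and the self-dual Weyl
tensor is triangular in a basis of self-dual two-forms which begins with `dx₃ ∧ dx₄` (`sdTensor`).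

The trace of the Jacobi operator `R_X` is `ρ(X, X)`, so a pointwise Osserman metric is Einstein
(`exists_ricci_eq_of_osserman`). If the metric is also self-dual, its curvature is
`riem_of_einsteinSelfDual`: a part of constant sectional curvature and `sdTensor`, which only
involves `τ`, `W⁺₁₁` and `W⁺₁₂`. The self-dual forms act on vectors as skew endomorphisms `A₁, A₂,
A₃`, and for `g(X, X) = ε ≠ 0` the vectors `X, A₁X, A₂X, A₃X` form a basis, in which `R_X` is an
upper triangular matrix with diagonal `0, ετ/24, ετ/6, ετ/24` and with the remaining entries
determined by `W⁺₁₁` and `W⁺₁₂` (`isConj_modelJacobi`). Hence Einstein self-dual Walker metrics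
are pointwise Osserman, and all assertions on the Jordan form of `R_X` are statements about this
explicit matrix.

It remains to solve the Einstein and self-duality equations. They fix all second derivatives in
`(x₁, x₂)`, so that `a`, `b`, `c` are quadratic polynomials in `(x₁, x₂)`; since the slices are
connected, the coefficients are smooth functions of `(x₃, x₄)` (`exists_eq_comp_proj`,
`exists_isQuadratic`). The remaining Einstein equations are affine in `(x₁, x₂)`: their linear
terms say that the scalar curvature is constant, and their constant terms are the system
`CoeffEqs` (`exists_isQuadratic_const`). When `τ ≠ 0` this system can be solved for `ξ`, `η`, `γ`,
and when `τ = 0` it is the first-order system of the Ricci-flat normal form, so both normal forms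
are instances of one.
-/

namespace Walker

open scoped Topology

/-! ### Partial derivatives -/

lemma pd_congr {f g : (Fin 4 → ℝ) → ℝ} {x : Fin 4 → ℝ} (h : f =ᶠ[nhds x] g) (i : Fin 4) :
    pd i f x = pd i g x := by
  rw [pd, pd, h.fderiv_eq]

lemma pd_const (i : Fin 4) (r : ℝ) (x : Fin 4 → ℝ) : pd i (fun _ => r) x = 0 := by
  simp [pd]

lemma pd_add {f g : (Fin 4 → ℝ) → ℝ} {x : Fin 4 → ℝ} (hf : DifferentiableAt ℝ f x)
    (hg : DifferentiableAt ℝ g x) (i : Fin 4) :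
    pd i (fun y => f y + g y) x = pd i f x + pd i g x := by
  simp [pd, fderiv_fun_add hf hg]

lemma pd_sub {f g : (Fin 4 → ℝ) → ℝ} {x : Fin 4 → ℝ} (hf : DifferentiableAt ℝ f x)
    (hg : DifferentiableAt ℝ g x) (i : Fin 4) :
    pd i (fun y => f y - g y) x = pd i f x - pd i g x := by
  simp [pd, fderiv_fun_sub hf hg]

lemma pd_mul {f g : (Fin 4 → ℝ) → ℝ} {x : Fin 4 → ℝ} (hf : DifferentiableAt ℝ f x)
    (hg : DifferentiableAt ℝ g x) (i : Fin 4) :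
    pd i (fun y => f y * g y) x = pd i f x * g x + f x * pd i g x := by
  simp [pd, fderiv_fun_mul hf hg]
  ring

lemma pd_const_mul {f : (Fin 4 → ℝ) → ℝ} {x : Fin 4 → ℝ} (r : ℝ) (hf : DifferentiableAt ℝ f x)
    (i : Fin 4) : pd i (fun y => r * f y) x = r * pd i f x := by
  simp [pd, fderiv_const_mul hf]

lemma pd_sum {f : Fin 4 → (Fin 4 → ℝ) → ℝ} {x : Fin 4 → ℝ}
    (hf : ∀ l, DifferentiableAt ℝ (f l) x) (i : Fin 4) :
    pd i (fun y => ∑ l, f l y) x = ∑ l, pd i (f l) x := by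
  simp [pd, fderiv_fun_sum (fun l _ => hf l)]

lemma pd_coord (i j : Fin 4) (x : Fin 4 → ℝ) :
    pd i (fun y => y j) x = if j = i then 1 else 0 := by
  have h : HasFDerivAt (fun y : Fin 4 → ℝ => y j)
      (ContinuousLinearMap.proj (R := ℝ) (φ := fun _ : Fin 4 => ℝ) j) x :=
    (ContinuousLinearMap.proj (R := ℝ) (φ := fun _ : Fin 4 => ℝ) j).hasFDerivAt
  rw [pd, h.fderiv]
  simp [Pi.single_apply]

lemma contDiffOn_pd {D : Set (Fin 4 → ℝ)} (hD : IsOpen D) {f : (Fin 4 → ℝ) → ℝ}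
    (hf : ContDiffOn ℝ ∞ f D) (i : Fin 4) : ContDiffOn ℝ ∞ (pd i f) D :=
  (hf.fderiv_of_isOpen hD (m := ∞) (by simp)).clm_apply contDiffOn_const

lemma differentiableAt_of_contDiffOn {D : Set (Fin 4 → ℝ)} (hD : IsOpen D)
    {f : (Fin 4 → ℝ) → ℝ} (hf : ContDiffOn ℝ ∞ f D) {x : Fin 4 → ℝ} (hx : x ∈ D) :
    DifferentiableAt ℝ f x :=
  (hf.contDiffAt (hD.mem_nhds hx)).differentiableAt (by simp)

lemma pd_comm {D : Set (Fin 4 → ℝ)} (hD : IsOpen D) {f : (Fin 4 → ℝ) → ℝ}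
    (hf : ContDiffOn ℝ ∞ f D) {x : Fin 4 → ℝ} (hx : x ∈ D) (i j : Fin 4) :
    pd i (pd j f) x = pd j (pd i f) x := by
  have h1 : IsSymmSndFDerivAt ℝ f x :=
    (hf.contDiffAt (hD.mem_nhds hx)).isSymmSndFDerivAt
      (by simpa using (WithTop.coe_le_coe.2 le_top : ((2 : ℕ∞) : WithTop ℕ∞) ≤ ∞))
  have h2 : DifferentiableAt ℝ (fderiv ℝ f) x :=
    ((hf.fderiv_of_isOpen hD (m := ∞) (by simp)).contDiffAt (hD.mem_nhds hx)).differentiableAt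
      (by simp)
  have key : ∀ i j, pd i (pd j f) x = fderiv ℝ (fderiv ℝ f) x (Pi.single i 1) (Pi.single j 1) := by
    intro i j
    have : pd j f = fun y => (fderiv ℝ f y) (Pi.single j 1) := rfl
    rw [this, pd, fderiv_clm_apply h2 (differentiableAt_const _)]
    simp
  rw [key, key, h1]

/-! ### The curvature tensor with lowered indices -/

/-- Christoffel symbols of the first kind: `g(∇_{∂ᵢ} ∂ⱼ, ∂ₗ)`. -/
noncomputable def christoffelFst (g : MetricField) (l i j : Fin 4) (x : Fin 4 → ℝ) : ℝ :=
  (1 / 2) * (pd i (fun y => g y j l) x + pd j (fun y => g y i l) x - pd l (fun y => g y i j) x)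

lemma christoffel_eq_sum (g : MetricField) (k i j : Fin 4) (x : Fin 4 → ℝ) :
    christoffel g k i j x = ∑ l, (g x)⁻¹ k l * christoffelFst g l i j x := by
  simp only [christoffel, christoffelFst, Finset.mul_sum]
  exact Finset.sum_congr rfl fun l _ => by ring

lemma sum_metric_mul_christoffel {g : MetricField} (hdet : ∀ y, IsUnit (g y).det)
    (hsymm : ∀ y i j, g y i j = g y j i) (s i j : Fin 4) (x : Fin 4 → ℝ) :
    ∑ l, christoffel g l i j x * g x l s = christoffelFst g s i j x := by
  have h : g x * (g x)⁻¹ = 1 := Matrix.mul_nonsing_inv _ (hdet x)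
  have h' : ∀ m, ∑ l, g x s l * (g x)⁻¹ l m = if s = m then 1 else 0 := fun m => by
    have := congrFun (congrFun h s) m
    rwa [Matrix.mul_apply, Matrix.one_apply] at this
  simp only [christoffel_eq_sum, Finset.sum_mul]
  rw [Finset.sum_comm]
  have : ∀ m, ∑ l, (g x)⁻¹ l m * christoffelFst g m i j x * g x l s
      = (∑ l, g x s l * (g x)⁻¹ l m) * christoffelFst g m i j x := fun m => by
    rw [Finset.sum_mul]
    exact Finset.sum_congr rfl fun l _ => by rw [hsymm x l s]; ring
  simp [this, h']

/-- The Levi-Civita connection is metric. -/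
lemma pd_metric {g : MetricField} (hsymm : ∀ y i j, g y i j = g y j i) (i m s : Fin 4)
    (x : Fin 4 → ℝ) :
    pd i (fun y => g y m s) x = christoffelFst g s i m x + christoffelFst g m i s x := by
  have h : ∀ j k, (fun y => g y j k) = fun y => g y k j := fun j k => funext fun y => hsymm y j k
  simp only [christoffelFst]
  rw [h i s, h i m, h s m]
  ring

/-- Lowering the last index of the curvature removes the derivatives of the inverse metric: the
covariant derivative commutes with the contraction against `g`. -/
lemma riem_eq {g : MetricField} (hdet : ∀ y, IsUnit (g y).det)
    (hsymm : ∀ y i j, g y i j = g y j i) {x : Fin 4 → ℝ}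
    (hg : ∀ i j, DifferentiableAt ℝ (fun y => g y i j) x)
    (hdg : ∀ k i j, DifferentiableAt ℝ (pd k fun y => g y i j) x)
    (hinv : ∀ i j, DifferentiableAt ℝ (fun y => (g y)⁻¹ i j) x) (i j k l : Fin 4) :
    riem g i j k l x = -(pd i (christoffelFst g l j k) x - pd j (christoffelFst g l i k) x)
      + ∑ m, (christoffelFst g m i l x * christoffel g m j k x
        - christoffelFst g m j l x * christoffel g m i k x) := by
  have hF : ∀ l i j, DifferentiableAt ℝ (christoffelFst g l i j) x := fun l i j => by
    unfold christoffelFst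
    exact (((hdg _ _ _).add (hdg _ _ _)).sub (hdg _ _ _)).const_mul _
  have hC : ∀ k i j, DifferentiableAt ℝ (christoffel g k i j) x := fun k i j => by
    rw [funext (christoffel_eq_sum g k i j)]
    exact DifferentiableAt.fun_sum fun l _ => (hinv k l).mul (hF l i j)
  have key : ∀ i j k l, ∑ m, pd i (christoffel g m j k) x * g x m l
      = pd i (christoffelFst g l j k) x
        - ∑ m, christoffel g m j k x * (christoffelFst g l i m x + christoffelFst g m i l x) := by
    intro i j k l
    have h : christoffelFst g l j k = fun y => ∑ m, christoffel g m j k y * g y m l :=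
      funext fun y => (sum_metric_mul_christoffel hdet hsymm l j k y).symm
    rw [h, pd_sum (f := fun m y => christoffel g m j k y * g y m l)
      (fun m => (hC m j k).mul (hg m l)), ← Finset.sum_sub_distrib]
    refine Finset.sum_congr rfl fun m _ => ?_
    rw [pd_mul (hC m j k) (hg m l), pd_metric hsymm i m l]
    ring
  have key2 : ∀ i j k l, ∑ n, (∑ m, christoffel g m j k x * christoffel g n i m x) * g x n l
      = ∑ m, christoffel g m j k x * christoffelFst g l i m x := by
    intro i j k l
    simp only [Finset.sum_mul]
    rw [Finset.sum_comm]
    refine Finset.sum_congr rfl fun m _ => ?_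
    rw [← sum_metric_mul_christoffel hdet hsymm l i m x, Finset.mul_sum]
    exact Finset.sum_congr rfl fun n _ => by ring
  have e : riem g i j k l x = -(∑ m, pd i (christoffel g m j k) x * g x m l
      - ∑ m, pd j (christoffel g m i k) x * g x m l
      + (∑ n, (∑ m, christoffel g m j k x * christoffel g n i m x) * g x n l
        - ∑ n, (∑ m, christoffel g m i k x * christoffel g n j m x) * g x n l)) := by
    simp only [riem, curv, ← Finset.sum_sub_distrib, ← Finset.sum_add_distrib,
      ← Finset.sum_neg_distrib]
    refine Finset.sum_congr rfl fun m _ => ?_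
    rw [Finset.sum_sub_distrib]
    ring
  rw [e, key, key, key2, key2]
  simp only [mul_add, Finset.sum_add_distrib, Finset.sum_sub_distrib]
  simp only [mul_comm (christoffelFst g _ _ _ x)]
  ring

/-- Raising the last index of the lowered curvature. -/
lemma curv_eq_sum {g : MetricField} {x : Fin 4 → ℝ} (hdet : IsUnit (g x).det) (i j k l : Fin 4) :
    curv g i j k l x = ∑ m, riem g i j k m x * (g x)⁻¹ m l := by
  have h : g x * (g x)⁻¹ = 1 := Matrix.mul_nonsing_inv _ hdet
  have h' : ∀ n, ∑ m, g x n m * (g x)⁻¹ m l = if n = l then 1 else 0 := fun n => by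
    have := congrFun (congrFun h n) l
    rwa [Matrix.mul_apply, Matrix.one_apply] at this
  simp only [riem, Finset.sum_mul]
  rw [Finset.sum_comm]
  simp [mul_assoc, ← Finset.mul_sum, h']

lemma riem_swap_fst (g : MetricField) (i j k l : Fin 4) (x : Fin 4 → ℝ) :
    riem g j i k l x = -riem g i j k l x := by
  simp only [riem, curv, ← Finset.sum_neg_distrib]
  refine Finset.sum_congr rfl fun m _ => ?_
  rw [← neg_mul]
  congr 1
  simp only [Finset.sum_sub_distrib]
  ring

/-- The part of the lowered curvature that is linear in the second derivatives of the metric: the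
terms `∂ᵢ∂ⱼ g` and `∂ⱼ∂ᵢ g` cancel. -/
lemma pd_christoffelFst_sub {g : MetricField} {x : Fin 4 → ℝ}
    (hdg : ∀ k i j, DifferentiableAt ℝ (pd k fun y => g y i j) x)
    (hcomm : ∀ k l i j, pd k (pd l fun y => g y i j) x = pd l (pd k fun y => g y i j) x)
    (i j k l : Fin 4) :
    pd i (christoffelFst g l j k) x - pd j (christoffelFst g l i k) x
      = (1 / 2) * (pd i (pd k fun y => g y j l) x - pd i (pd l fun y => g y j k) x
        - pd j (pd k fun y => g y i l) x + pd j (pd l fun y => g y i k) x) := by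
  have h : ∀ i l j k, pd i (christoffelFst g l j k) x = (1 / 2) * (pd i (pd j fun y => g y k l) x
      + pd i (pd k fun y => g y j l) x - pd i (pd l fun y => g y j k) x) := by
    intro i l j k
    have : christoffelFst g l j k = fun y => (1 / 2) * (pd j (fun y => g y k l) y
      + pd k (fun y => g y j l) y - pd l (fun y => g y j k) y) := rfl
    rw [this, pd_const_mul _ (((hdg _ _ _).fun_add (hdg _ _ _)).fun_sub (hdg _ _ _)),
      pd_sub ((hdg _ _ _).fun_add (hdg _ _ _)) (hdg _ _ _), pd_add (hdg _ _ _) (hdg _ _ _)]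
  rw [h, h, hcomm j i]
  ring

/-! ### Tensors with two antisymmetric pairs of indices -/

/-- The antisymmetric matrix with the given entries above the diagonal, in lexicographic order. -/
def skew (p01 p02 p03 p12 p13 p23 : ℝ) : Matrix (Fin 4) (Fin 4) ℝ :=
  !![0, p01, p02, p03; -p01, 0, p12, p13; -p02, -p12, 0, p23; -p03, -p13, -p23, 0]

/-- An antisymmetric array vanishes if its entries above the diagonal do. -/
lemma eq_zero_of_antisymm {F : Fin 4 → Fin 4 → ℝ} (h : ∀ i j, F j i = -F i j)
    (h01 : F 0 1 = 0) (h02 : F 0 2 = 0) (h03 : F 0 3 = 0) (h12 : F 1 2 = 0) (h13 : F 1 3 = 0)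
    (h23 : F 2 3 = 0) (i j : Fin 4) : F i j = 0 := by
  have hd : ∀ i, F i i = 0 := fun i => by linarith [h i i]
  fin_cases i <;> fin_cases j <;> simp only [Fin.reduceFinMk, Fin.zero_eta, Fin.mk_one, Fin.isValue,
    hd, h01, h02, h03, h12, h13, h23, h 0 1, h 0 2, h 0 3, h 1 2, h 1 3, h 2 3, neg_zero]

lemma skew_swap (p01 p02 p03 p12 p13 p23 : ℝ) (i j : Fin 4) :
    skew p01 p02 p03 p12 p13 p23 j i = -skew p01 p02 p03 p12 p13 p23 i j := by
  fin_cases i <;> fin_cases j <;> simp [skew]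

/-! ### The curvature of a Walker metric -/

section Metric

variable (a b c : (Fin 4 → ℝ) → ℝ) (x : Fin 4 → ℝ)

lemma walker_symm (i j : Fin 4) : walker a b c x i j = walker a b c x j i := by
  fin_cases i <;> fin_cases j <;> rfl

lemma walker_det : (walker a b c x).det = 1 := by
  simp [walker, Matrix.det_succ_row_zero, Fin.sum_univ_succ, Fin.succAbove]

lemma walker_inv : (walker a b c x)⁻¹ =
    !![-a x, -c x, 1, 0; -c x, -b x, 0, 1; 1, 0, 0, 0; 0, 1, 0, 0] := by
  refine Matrix.inv_eq_right_inv ?_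
  ext i j
  fin_cases i <;> fin_cases j <;> simp [walker, Matrix.mul_apply, Fin.sum_univ_four]

lemma isUnit_walker_det : IsUnit (walker a b c x).det := by simp [walker_det]

lemma pd_walker (k i j : Fin 4) : pd k (fun y => walker a b c y i j) =
    fun x => !![0, 0, 0, 0; 0, 0, 0, 0; 0, 0, pd k a x, pd k c x;
      0, 0, pd k c x, pd k b x] i j := by
  funext x
  fin_cases i <;> fin_cases j <;>
    simp [walker, pd_const]

lemma pd_pd_walker (k l i j : Fin 4) : pd k (pd l (fun y => walker a b c y i j)) x =
    !![0, 0, 0, 0; 0, 0, 0, 0; 0, 0, pd k (pd l a) x, pd k (pd l c) x;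
      0, 0, pd k (pd l c) x, pd k (pd l b) x] i j := by
  rw [pd_walker]
  fin_cases i <;> fin_cases j <;> simp [pd_const]

lemma christoffelFst_walker (l i j : Fin 4) : christoffelFst (walker a b c) l i j x =
    (1 / 2) * (
      !![0, 0, 0, 0; 0, 0, 0, 0; 0, 0, pd i a x, pd i c x; 0, 0, pd i c x, pd i b x] j l
      + !![0, 0, 0, 0; 0, 0, 0, 0; 0, 0, pd j a x, pd j c x; 0, 0, pd j c x, pd j b x] i l
      - !![0, 0, 0, 0; 0, 0, 0, 0; 0, 0, pd l a x, pd l c x; 0, 0, pd l c x, pd l b x] i j) := by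
  simp only [christoffelFst, pd_walker]

end Metric

/-- The standing assumption on the coefficients of the Walker metrics: they are smooth functions on
an open set. -/
structure SmoothWalker (D : Set (Fin 4 → ℝ)) (a b c : (Fin 4 → ℝ) → ℝ) : Prop where
  isOpen : IsOpen D
  smooth_a : ContDiffOn ℝ ∞ a D
  smooth_b : ContDiffOn ℝ ∞ b D
  smooth_c : ContDiffOn ℝ ∞ c D

variable {D : Set (Fin 4 → ℝ)} {a b c : (Fin 4 → ℝ) → ℝ} {x : Fin 4 → ℝ}

lemma SmoothWalker.pd_pd_comm (h : SmoothWalker D a b c) (hx : x ∈ D) (k l i j : Fin 4) :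
    pd k (pd l fun y => walker a b c y i j) x = pd l (pd k fun y => walker a b c y i j) x := by
  rw [pd_pd_walker, pd_pd_walker, pd_comm h.isOpen h.smooth_a hx k l,
    pd_comm h.isOpen h.smooth_b hx k l, pd_comm h.isOpen h.smooth_c hx k l]

/-- The lowered curvature of a Walker metric; the symmetries of the curvature tensor are read off
from this formula. -/
lemma riem_walker (h : SmoothWalker D a b c) (hx : x ∈ D) (i j k l : Fin 4) :
    riem (walker a b c) i j k l x = -((1 / 2) * (
        pd i (pd k fun y => walker a b c y j l) x - pd i (pd l fun y => walker a b c y j k) x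
        - pd j (pd k fun y => walker a b c y i l) x + pd j (pd l fun y => walker a b c y i k) x))
      + ∑ m, (christoffelFst (walker a b c) m i l x * christoffel (walker a b c) m j k x
        - christoffelFst (walker a b c) m j l x * christoffel (walker a b c) m i k x) := by
  obtain ⟨hD, ha, hb, hc⟩ := id h
  have da := differentiableAt_of_contDiffOn hD ha hx
  have db := differentiableAt_of_contDiffOn hD hb hx
  have dc := differentiableAt_of_contDiffOn hD hc hx
  have dpa := fun i => differentiableAt_of_contDiffOn hD (contDiffOn_pd hD ha i) hx
  have dpb := fun i => differentiableAt_of_contDiffOn hD (contDiffOn_pd hD hb i) hx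
  have dpc := fun i => differentiableAt_of_contDiffOn hD (contDiffOn_pd hD hc i) hx
  have hdg : ∀ k i j, DifferentiableAt ℝ (pd k fun y => walker a b c y i j) x := by
    intro k i j
    rw [pd_walker]
    fin_cases i <;> fin_cases j <;> simp [dpa, dpb, dpc]
  rw [riem_eq (isUnit_walker_det a b c) (walker_symm a b c) ?_ hdg ?_,
    pd_christoffelFst_sub hdg]
  · exact h.pd_pd_comm hx
  · intro i j
    fin_cases i <;> fin_cases j <;> simp [walker, da, db, dc]
  · intro i j
    simp only [walker_inv]
    fin_cases i <;> fin_cases j <;> simp [da, db, dc]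

/-! #### Symmetries of the curvature

The conditional forms let `simp` bring the indices of a component into a canonical order. -/

lemma riem_swap_fst_of_lt (g : MetricField) (x : Fin 4 → ℝ) {i j : Fin 4} (_ : i < j)
    (k l : Fin 4) : riem g j i k l x = -riem g i j k l x :=
  riem_swap_fst g i j k l x

lemma riem_self_fst (g : MetricField) (x : Fin 4 → ℝ) (i k l : Fin 4) : riem g i i k l x = 0 := by
  linarith [riem_swap_fst g i i k l x]

lemma christoffelFst_symm (l i j : Fin 4) :
    christoffelFst (walker a b c) l i j x = christoffelFst (walker a b c) l j i x := by
  simp only [christoffelFst, fun y => walker_symm a b c y i j]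
  ring

lemma sum_christoffelFst_mul_symm (p q r s : Fin 4) :
    ∑ m, christoffelFst (walker a b c) m p q x * christoffel (walker a b c) m r s x
      = ∑ m, christoffelFst (walker a b c) m r s x * christoffel (walker a b c) m p q x := by
  simp only [christoffel_eq_sum, Finset.mul_sum]
  rw [Finset.sum_comm]
  refine Finset.sum_congr rfl fun m _ => Finset.sum_congr rfl fun n _ => ?_
  have : (walker a b c x)⁻¹ n m = (walker a b c x)⁻¹ m n := by
    rw [walker_inv]
    fin_cases m <;> fin_cases n <;> rfl
  rw [this]
  ring

lemma riem_swap_snd (h : SmoothWalker D a b c) (hx : x ∈ D) (i j k l : Fin 4) :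
    riem (walker a b c) i j l k x = -riem (walker a b c) i j k l x := by
  simp only [riem_walker h hx, Finset.sum_sub_distrib]
  rw [sum_christoffelFst_mul_symm i k j l, sum_christoffelFst_mul_symm j k i l]
  ring

lemma riem_pair_symm (h : SmoothWalker D a b c) (hx : x ∈ D) (i j k l : Fin 4) :
    riem (walker a b c) k l i j x = riem (walker a b c) i j k l x := by
  simp only [riem_walker h hx, Finset.sum_sub_distrib]
  have hB : ∀ p q r s,
      ∑ m, christoffelFst (walker a b c) m p q x * christoffel (walker a b c) m r s x
      = ∑ m, christoffelFst (walker a b c) m q p x * christoffel (walker a b c) m s r x :=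
    fun p q r s => Finset.sum_congr rfl fun m _ => by
      simp only [christoffel_eq_sum, christoffelFst_symm _ p q, christoffelFst_symm _ r s]
  have hg : ∀ i j, (fun y => walker a b c y i j) = fun y => walker a b c y j i :=
    fun i j => funext fun y => walker_symm a b c y i j
  rw [hB k j l i, hB l j k i, sum_christoffelFst_mul_symm j k i l, h.pd_pd_comm hx k i,
    h.pd_pd_comm hx k j, h.pd_pd_comm hx l i, h.pd_pd_comm hx l j,
    hg l j, hg l i, hg k j, hg k i]
  ring

lemma riem_swap_snd_of_lt (h : SmoothWalker D a b c) (hx : x ∈ D) (i j : Fin 4) {k l : Fin 4}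
    (_ : k < l) : riem (walker a b c) i j l k x = -riem (walker a b c) i j k l x :=
  riem_swap_snd h hx i j k l

lemma riem_self_snd (h : SmoothWalker D a b c) (hx : x ∈ D) (i j k : Fin 4) :
    riem (walker a b c) i j k k x = 0 := by
  linarith [riem_swap_snd h hx i j k k]

lemma riem_pair_symm_of_lt (h : SmoothWalker D a b c) (hx : x ∈ D) {i k : Fin 4} (_ : i < k)
    (j l : Fin 4) : riem (walker a b c) k l i j x = riem (walker a b c) i j k l x :=
  riem_pair_symm h hx i j k l

lemma riem_pair_symm_of_lt' (h : SmoothWalker D a b c) (hx : x ∈ D) (i : Fin 4) {j l : Fin 4}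
    (_ : j < l) : riem (walker a b c) i l i j x = riem (walker a b c) i j i l x :=
  riem_pair_symm h hx i j i l

/-- The curvature of a Walker metric, up to the symmetries of the curvature tensor. -/
lemma riem_walker_components (h : SmoothWalker D a b c) (hx : x ∈ D) :
    riem (walker a b c) 0 1 0 1 x = 0 ∧
    riem (walker a b c) 0 1 0 2 x = 0 ∧
    riem (walker a b c) 0 1 0 3 x = 0 ∧
    riem (walker a b c) 0 1 1 2 x = 0 ∧
    riem (walker a b c) 0 1 1 3 x = 0 ∧
    riem (walker a b c) 0 1 2 3 x = 0 ∧
    riem (walker a b c) 0 2 0 2 x = -pd 0 (pd 0 a) x / 2 ∧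
    riem (walker a b c) 0 2 0 3 x = -pd 0 (pd 0 c) x / 2 ∧
    riem (walker a b c) 0 2 1 2 x = -pd 0 (pd 1 a) x / 2 ∧
    riem (walker a b c) 0 2 1 3 x = -pd 0 (pd 1 c) x / 2 ∧
    riem (walker a b c) 0 2 2 3 x = pd 0 (pd 3 a) x / 2 - pd 0 (pd 2 c) x / 2
      - pd 1 a x * pd 0 b x / 4 + pd 0 c x * pd 1 c x / 4 ∧
    riem (walker a b c) 0 3 0 3 x = -pd 0 (pd 0 b) x / 2 ∧
    riem (walker a b c) 0 3 1 2 x = -pd 0 (pd 1 c) x / 2 ∧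
    riem (walker a b c) 0 3 1 3 x = -pd 0 (pd 1 b) x / 2 ∧
    riem (walker a b c) 0 3 2 3 x = -pd 0 (pd 2 b) x / 2 + pd 0 (pd 3 c) x / 2
      + pd 0 a x * pd 0 b x / 4 - pd 0 b x * pd 1 c x / 4 + pd 1 b x * pd 0 c x / 4
      - pd 0 c x ^ 2 / 4 ∧
    riem (walker a b c) 1 2 1 2 x = -pd 1 (pd 1 a) x / 2 ∧
    riem (walker a b c) 1 2 1 3 x = -pd 1 (pd 1 c) x / 2 ∧
    riem (walker a b c) 1 2 2 3 x = pd 1 (pd 3 a) x / 2 - pd 1 (pd 2 c) x / 2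
      - pd 0 a x * pd 1 c x / 4 - pd 1 a x * pd 1 b x / 4 + pd 1 a x * pd 0 c x / 4
      + pd 1 c x ^ 2 / 4 ∧
    riem (walker a b c) 1 3 1 3 x = -pd 1 (pd 1 b) x / 2 ∧
    riem (walker a b c) 1 3 2 3 x = -pd 1 (pd 2 b) x / 2 + pd 1 (pd 3 c) x / 2
      + pd 1 a x * pd 0 b x / 4 - pd 0 c x * pd 1 c x / 4 ∧
    riem (walker a b c) 2 3 2 3 x = -pd 3 (pd 3 a) x / 2 - pd 2 (pd 2 b) x / 2 + pd 2 (pd 3 c) x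
      - pd 0 a x * pd 2 b x / 4 + pd 0 a x * pd 3 c x / 2 + pd 1 a x * pd 3 b x / 4
      + pd 2 a x * pd 0 b x / 4 - pd 3 a x * pd 1 b x / 4 - pd 3 a x * pd 0 c x / 2
      + pd 1 b x * pd 2 c x / 2 - pd 2 b x * pd 1 c x / 2 + a x * pd 0 a x * pd 0 b x / 4
      - a x * pd 0 c x ^ 2 / 4 + pd 0 a x * pd 1 b x * c x / 4 + pd 1 a x * b x * pd 1 b x / 4
      + pd 1 a x * pd 0 b x * c x / 4 - b x * pd 1 c x ^ 2 / 4
      - c x * pd 0 c x * pd 1 c x / 2 := by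
  have sa := fun i j => pd_comm h.isOpen h.smooth_a hx i j
  have sb := fun i j => pd_comm h.isOpen h.smooth_b hx i j
  have sc := fun i j => pd_comm h.isOpen h.smooth_c hx i j
  refine ⟨?_, ?_, ?_, ?_, ?_, ?_, ?_, ?_, ?_, ?_, ?_, ?_, ?_, ?_, ?_, ?_, ?_, ?_, ?_, ?_, ?_⟩ <;>
  · simp [riem_walker h hx, pd_pd_walker, Fin.sum_univ_four, christoffel_eq_sum, walker_inv,
      christoffelFst_walker, sa 1 0, sa 2 0, sa 3 0, sa 2 1, sa 3 1, sa 3 2, sb 1 0, sb 2 0, sb 3 0,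
      sb 2 1, sb 3 1, sb 3 2, sc 1 0, sc 2 0, sc 3 0, sc 2 1, sc 3 1, sc 3 2]
    try ring

lemma ricci_eq_sum (i j : Fin 4) : ricci (walker a b c) i j x =
    ∑ u, ∑ m, riem (walker a b c) i u j m x * (walker a b c x)⁻¹ m u := by
  simp only [ricci, curv_eq_sum (isUnit_walker_det a b c x)]

lemma ricci_symm (h : SmoothWalker D a b c) (hx : x ∈ D) (i j : Fin 4) :
    ricci (walker a b c) j i x = ricci (walker a b c) i j x := by
  rw [ricci_eq_sum, ricci_eq_sum, Finset.sum_comm]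
  refine Finset.sum_congr rfl fun u _ => Finset.sum_congr rfl fun m _ => ?_
  rw [riem_pair_symm h hx i u j m]
  congr 1
  rw [walker_inv]
  fin_cases m <;> fin_cases u <;> rfl

lemma ricci_walker_components (h : SmoothWalker D a b c) (hx : x ∈ D) :
    ricci (walker a b c) 0 0 x = 0 ∧
    ricci (walker a b c) 0 1 x = 0 ∧
    ricci (walker a b c) 0 2 x = pd 0 (pd 0 a) x / 2 + pd 0 (pd 1 c) x / 2 ∧
    ricci (walker a b c) 0 3 x = pd 0 (pd 1 b) x / 2 + pd 0 (pd 0 c) x / 2 ∧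
    ricci (walker a b c) 1 1 x = 0 ∧
    ricci (walker a b c) 1 2 x = pd 0 (pd 1 a) x / 2 + pd 1 (pd 1 c) x / 2 ∧
    ricci (walker a b c) 1 3 x = pd 1 (pd 1 b) x / 2 + pd 0 (pd 1 c) x / 2 ∧
    ricci (walker a b c) 2 2 x = -pd 1 (pd 3 a) x + pd 1 (pd 2 c) x + a x * pd 0 (pd 0 a) x / 2
      + pd 0 a x * pd 1 c x / 2 + pd 0 (pd 1 a) x * c x + pd 1 a x * pd 1 b x / 2
      - pd 1 a x * pd 0 c x / 2 + pd 1 (pd 1 a) x * b x / 2 - pd 1 c x ^ 2 / 2 ∧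
    ricci (walker a b c) 2 3 x = pd 0 (pd 3 a) x / 2 + pd 1 (pd 2 b) x / 2 - pd 0 (pd 2 c) x / 2
      - pd 1 (pd 3 c) x / 2 + a x * pd 0 (pd 0 c) x / 2 - pd 1 a x * pd 0 b x / 2
      + b x * pd 1 (pd 1 c) x / 2 + c x * pd 0 (pd 1 c) x + pd 0 c x * pd 1 c x / 2 ∧
    ricci (walker a b c) 3 3 x = -pd 0 (pd 2 b) x + pd 0 (pd 3 c) x + a x * pd 0 (pd 0 b) x / 2
      + pd 0 a x * pd 0 b x / 2 + b x * pd 1 (pd 1 b) x / 2 - pd 0 b x * pd 1 c x / 2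
      + pd 0 (pd 1 b) x * c x + pd 1 b x * pd 0 c x / 2 - pd 0 c x ^ 2 / 2 := by
  have hR := riem_walker_components h hx
  refine ⟨?_, ?_, ?_, ?_, ?_, ?_, ?_, ?_, ?_, ?_⟩ <;>
  · simp [ricci_eq_sum, Fin.sum_univ_four, walker_inv, riem_swap_fst_of_lt,
      riem_swap_snd_of_lt h hx, riem_self_fst, riem_self_snd h hx, riem_pair_symm_of_lt h hx,
      riem_pair_symm_of_lt' h hx, hR]
    try ring

lemma scal_walker (h : SmoothWalker D a b c) (hx : x ∈ D) :
    scal (walker a b c) x = pd 0 (pd 0 a) x + pd 1 (pd 1 b) x + 2 * pd 0 (pd 1 c) x := by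
  have hr := ricci_walker_components h hx
  have hs := ricci_symm h hx
  simp [scal, Fin.sum_univ_four, walker_inv, hs 0 1, hs 0 2, hs 1 3, hr]
  ring

/-! ### The Weyl tensor on bivectors -/

lemma weyl_swap_fst (g : MetricField) (i j k l : Fin 4) :
    weyl g j i k l x = -weyl g i j k l x := by
  simp only [weyl, riem_swap_fst g i j]
  ring

lemma weyl_swap_snd (h : SmoothWalker D a b c) (hx : x ∈ D) (i j k l : Fin 4) :
    weyl (walker a b c) i j l k x = -weyl (walker a b c) i j k l x := by
  simp only [weyl, riem_swap_snd h hx i j k]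
  ring

/-- A double sum over antisymmetric arrays runs twice over each pair `i < j`. -/
lemma sum_mul_of_antisymm {A B : Fin 4 → Fin 4 → ℝ} (hA : ∀ i j, A j i = -A i j)
    (hB : ∀ i j, B j i = -B i j) :
    ∑ i, ∑ j, A i j * B i j = 2 * (A 0 1 * B 0 1 + A 0 2 * B 0 2 + A 0 3 * B 0 3 + A 1 2 * B 1 2
      + A 1 3 * B 1 3 + A 2 3 * B 2 3) := by
  have hd : ∀ i, A i i = 0 := fun i => by linarith [hA i i]
  simp only [Fin.sum_univ_four, hd, hA 0 1, hA 0 2, hA 0 3, hA 1 2, hA 1 3, hA 2 3, hB 0 1, hB 0 2,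
    hB 0 3, hB 1 2, hB 1 3, hB 2 3]
  ring

lemma weylBivector_skew (h : SmoothWalker D a b c) (hx : x ∈ D)
    (p01 p02 p03 p12 p13 p23 q01 q02 q03 q12 q13 q23 : ℝ) :
    let W := fun i j k l => weyl (walker a b c) i j k l x
    let L := fun i j => q01 * W i j 0 1 + q02 * W i j 0 2 + q03 * W i j 0 3 + q12 * W i j 1 2
      + q13 * W i j 1 3 + q23 * W i j 2 3
    weylBivector (walker a b c) (skew p01 p02 p03 p12 p13 p23) (skew q01 q02 q03 q12 q13 q23) x
      = p01 * L 0 1 + p02 * L 0 2 + p03 * L 0 3 + p12 * L 1 2 + p13 * L 1 3 + p23 * L 2 3 := by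
  intro W L
  have hsk := skew_swap p01 p02 p03 p12 p13 p23
  have hsq := skew_swap q01 q02 q03 q12 q13 q23
  have inner_sum : ∀ i j, ∑ k, ∑ l, skew q01 q02 q03 q12 q13 q23 k l * W i j k l = 2 * L i j := by
    intro i j
    rw [sum_mul_of_antisymm hsq (weyl_swap_snd h hx i j)]
    rfl
  have hL : ∀ i j, L j i = -L i j := fun i j => by
    simp only [L, W, weyl_swap_fst _ i j]
    ring
  have : ∀ i j, ∑ k, ∑ l, skew p01 p02 p03 p12 p13 p23 i j * skew q01 q02 q03 q12 q13 q23 k l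
      * weyl (walker a b c) i j k l x = skew p01 p02 p03 p12 p13 p23 i j * (2 * L i j) := by
    intro i j
    rw [← inner_sum, Finset.mul_sum]
    refine Finset.sum_congr rfl fun k _ => ?_
    rw [Finset.mul_sum]
    exact Finset.sum_congr rfl fun l _ => mul_assoc _ _ _
  simp only [weylBivector, this]
  rw [sum_mul_of_antisymm hsk (fun i j => by rw [hL]; ring)]
  simp [skew]
  ring

/-- `√2 E₁⁺` is the bivector `∂₁ ∧ ∂₂ / 2 + 2 (∂₃ - a/2 ∂₁) ∧ (∂₄ - c ∂₁ - b/2 ∂₂)`. -/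
lemma sdBasis_zero : sdBasis a b c x 0 = (Real.sqrt 2)⁻¹ •
    skew ((1 + a x * b x) / 2) (2 * c x) (-a x) (b x) 0 2 := by
  simp only [sdBasis, Matrix.cons_val_zero]
  congr 1
  ext i j
  fin_cases i <;> fin_cases j <;> simp [wedge, frame, skew] <;> ring

lemma sdBasis_one : sdBasis a b c x 1 = (Real.sqrt 2)⁻¹ • skew (c x) 1 0 0 1 0 := by
  simp only [sdBasis, Matrix.cons_val_one, Matrix.cons_val_zero]
  congr 1
  ext i j
  fin_cases i <;> fin_cases j <;> simp [wedge, frame, skew] <;> ring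

lemma weylBivector_smul (g : MetricField) (r s : ℝ) (A B : Matrix (Fin 4) (Fin 4) ℝ) :
    weylBivector g (r • A) (s • B) x = r * s * weylBivector g A B x := by
  simp only [weylBivector, Finset.mul_sum, Matrix.smul_apply, smul_eq_mul]
  refine Finset.sum_congr rfl fun i _ => Finset.sum_congr rfl fun j _ =>
    Finset.sum_congr rfl fun k _ => Finset.sum_congr rfl fun l _ => ?_
  ring

lemma inv_sqrt_two_mul_self : (Real.sqrt 2)⁻¹ * (Real.sqrt 2)⁻¹ = 1 / 2 := by
  rw [← mul_inv, Real.mul_self_sqrt zero_le_two, one_div]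

lemma wPlus_zero_zero (h : SmoothWalker D a b c) (hx : x ∈ D) :
    wPlus a b c 0 0 x = w11Expr a b c x := by
  rw [wPlus, sdBasis_zero, weylBivector_smul, inv_sqrt_two_mul_self, weylBivector_skew h hx]
  have hR := riem_walker_components h hx
  have hr := ricci_walker_components h hx
  have hs := ricci_symm h hx
  simp [weyl, walker, riem_pair_symm_of_lt h hx, riem_pair_symm_of_lt' h hx, hR, hs 0 1, hs 0 2,
    hs 0 3, hs 1 2, hs 1 3, hs 2 3, hr, scal_walker h hx, w11Expr]
  ring

lemma wPlus_zero_one (h : SmoothWalker D a b c) (hx : x ∈ D) :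
    wPlus a b c 0 1 x = w12Expr a b c x := by
  rw [wPlus, sdBasis_zero, sdBasis_one, weylBivector_smul, inv_sqrt_two_mul_self,
    weylBivector_skew h hx]
  have hR := riem_walker_components h hx
  have hr := ricci_walker_components h hx
  have hs := ricci_symm h hx
  simp [weyl, walker, riem_pair_symm_of_lt h hx, riem_pair_symm_of_lt' h hx, hR, hs 0 1, hs 0 2,
    hs 0 3, hs 1 2, hs 1 3, hs 2 3, hr, scal_walker h hx, w12Expr]
  ring

/-! ### Self-duality -/

lemma det_fin_four (u v w z : Fin 4 → ℝ) : Matrix.det (Matrix.of ![u, v, w, z]) =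
    (u 0 * v 1 - u 1 * v 0) * (w 2 * z 3 - w 3 * z 2)
    - (u 0 * v 2 - u 2 * v 0) * (w 1 * z 3 - w 3 * z 1)
    + (u 0 * v 3 - u 3 * v 0) * (w 1 * z 2 - w 2 * z 1)
    + (u 1 * v 2 - u 2 * v 1) * (w 0 * z 3 - w 3 * z 0)
    - (u 1 * v 3 - u 3 * v 1) * (w 0 * z 2 - w 2 * z 0)
    + (u 2 * v 3 - u 3 * v 2) * (w 0 * z 1 - w 1 * z 0) := by
  simp [Matrix.det_succ_row_zero, Fin.sum_univ_succ, Fin.succAbove]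
  ring

/-- Contraction of an array with the last two indices of the volume form. -/
lemma sum_vol_mul (B : Fin 4 → Fin 4 → ℝ) (i j : Fin 4) :
    ∑ m, ∑ n, vol (walker a b c) i j m n x * B m n =
      skew (B 2 3 - B 3 2) (B 3 1 - B 1 3) (B 1 2 - B 2 1) (B 0 3 - B 3 0) (B 2 0 - B 0 2)
        (B 0 1 - B 1 0) i j := by
  simp only [vol, walker_det, abs_one, Real.sqrt_one, one_mul, det_fin_four]
  fin_cases i <;> fin_cases j <;>
  · simp [Fin.sum_univ_four, skew]
    try ring

/-- The Hodge star of the two-form with coefficients `F`. -/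
noncomputable def starForm (g : MetricField) (x : Fin 4 → ℝ) (F : Fin 4 → Fin 4 → ℝ)
    (i j : Fin 4) : ℝ :=
  (1 / 2) * ∑ m, ∑ n, vol g i j m n x * ∑ r, ∑ s, (g x)⁻¹ m r * (g x)⁻¹ n s * F r s

lemma starWeyl_eq_starForm (g : MetricField) (i j k l : Fin 4) :
    starWeyl g i j k l x = starForm g x (fun r s => weyl g r s k l x) i j := by
  simp only [starWeyl, starForm, Finset.mul_sum, mul_assoc]

/-- The Hodge star of a two-form, in coordinates adapted to the null distribution. -/
lemma starForm_walker {F : Fin 4 → Fin 4 → ℝ} (hF : ∀ i j, F j i = -F i j) (i j : Fin 4) :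
    starForm (walker a b c) x F i j =
      skew (F 0 1) (c x * F 0 1 + F 1 3) (b x * F 0 1 - F 0 3) (-(a x * F 0 1) - F 1 2)
        (-(c x * F 0 1) + F 0 2) ((a x * b x - c x ^ 2) * F 0 1 + c x * F 0 2 - a x * F 0 3
          + b x * F 1 2 - c x * F 1 3 + F 2 3) i j := by
  simp only [starForm, sum_vol_mul, walker_inv]
  have hd : ∀ i, F i i = 0 := fun i => by linarith [hF i i]
  fin_cases i <;> fin_cases j <;>
  · simp [Fin.sum_univ_four, skew, hd, hF 0 1, hF 0 2, hF 0 3, hF 1 2, hF 1 3, hF 2 3]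
    try ring

/-- The equations on second derivatives in `(x₁, x₂)` that express the vanishing of `W⁻`. -/
structure SelfDualEqs (a b c : (Fin 4 → ℝ) → ℝ) (x : Fin 4 → ℝ) : Prop where
  a_11 : pd 1 (pd 1 a) x = 0
  b_00 : pd 0 (pd 0 b) x = 0
  a_01 : pd 0 (pd 1 a) x = pd 1 (pd 1 c) x
  b_01 : pd 0 (pd 1 b) x = pd 0 (pd 0 c) x
  sum : pd 0 (pd 0 a) x + pd 1 (pd 1 b) x = 4 * pd 0 (pd 1 c) x

/-- Five components of `W⁻` suffice. -/
lemma selfDualEqs_of_weylMinus (h : SmoothWalker D a b c) (hx : x ∈ D)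
    (hW : ∀ i j k l, weylMinus (walker a b c) i j k l x = 0) : SelfDualEqs a b c x := by
  have hR := riem_walker_components h hx
  have hr := ricci_walker_components h hx
  have hs := ricci_symm h hx
  have key : ∀ i j k l, weyl (walker a b c) i j k l x = starForm (walker a b c) x
      (fun r s => weyl (walker a b c) r s k l x) i j := fun i j k l => by
    have := hW i j k l
    rw [weylMinus, starWeyl_eq_starForm] at this
    linarith
  have key' := fun i j k l =>
    (key i j k l).trans (starForm_walker (fun i j => weyl_swap_fst _ i j k l) i j)
  have e1 := key' 0 2 0 2
  have e2 := key' 0 2 0 3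
  have e3 := key' 0 3 0 3
  have e4 := key' 0 2 1 2
  have e5 := key' 1 2 1 2
  simp [skew, weyl, walker, riem_pair_symm_of_lt h hx, riem_pair_symm_of_lt' h hx, hR, hs 0 1,
    hs 0 2, hs 0 3, hs 1 2, hs 1 3, hs 2 3, hr, scal_walker h hx] at e1 e2 e3 e4 e5
  constructor <;> linarith

/-! ### Einstein self-dual Walker metrics -/

/-- The conditions, at a point, of being Einstein and self-dual. -/
structure EinsteinSelfDualAt (a b c : (Fin 4 → ℝ) → ℝ) (τ : ℝ) (x : Fin 4 → ℝ) : Prop where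
  ricci_eq : ∀ i j, ricci (walker a b c) i j x = τ / 4 * walker a b c x i j
  selfDual : SelfDualEqs a b c x

/-- The second derivatives along the null distribution spanned by `∂₁` and `∂₂`. -/
lemma EinsteinSelfDualAt.second_derivatives (h : SmoothWalker D a b c) (hx : x ∈ D) {τ : ℝ}
    (hE : EinsteinSelfDualAt a b c τ x) :
    pd 0 (pd 0 a) x = τ / 3 ∧ pd 0 (pd 1 a) x = 0 ∧ pd 1 (pd 1 a) x = 0 ∧
    pd 0 (pd 0 b) x = 0 ∧ pd 0 (pd 1 b) x = 0 ∧ pd 1 (pd 1 b) x = τ / 3 ∧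
    pd 0 (pd 0 c) x = 0 ∧ pd 0 (pd 1 c) x = τ / 6 ∧ pd 1 (pd 1 c) x = 0 := by
  obtain ⟨-, -, h02, h03, -, h12, h13, -⟩ := ricci_walker_components h hx
  obtain ⟨h1, h2, h3, h4, h5⟩ := hE.selfDual
  have e1 := hE.ricci_eq 0 2
  have e2 := hE.ricci_eq 0 3
  have e3 := hE.ricci_eq 1 2
  have e4 := hE.ricci_eq 1 3
  simp [walker, h02, h03, h12, h13] at e1 e2 e3 e4
  refine ⟨?_, ?_, ?_, ?_, ?_, ?_, ?_, ?_, ?_⟩ <;> linarith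

/-- The first of three two-forms spanning the self-dual forms: `dx₃ ∧ dx₄`. -/
def form1 : Matrix (Fin 4) (Fin 4) ℝ := skew 0 0 0 0 0 1

/-- The two-form metrically dual to `√2 E₂⁺`; `c` is the coefficient of the metric. -/
def form2 (c : ℝ) : Matrix (Fin 4) (Fin 4) ℝ := skew 0 (-1) 0 0 (-1) c

/-- The decomposable self-dual form metrically dual to `(∂₃ - a/2 ∂₁) ∧ (∂₄ - c ∂₁ - b/2 ∂₂)`. -/
noncomputable def form3 (a b c : ℝ) : Matrix (Fin 4) (Fin 4) ℝ :=
  skew 1 0 (b / 2) (-(a / 2)) (-c) (a * b / 4)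

/-- The part of the curvature of an Einstein self-dual Walker metric that is not of constant
sectional curvature: a quadratic form in the self-dual two-forms, with no `form3 ⊗ form3` and
`form2 ⊗ form3` terms because `∂₁` and `∂₂` span a parallel null distribution. -/
noncomputable def sdTensor (a b c τ α β : ℝ) (i j k l : Fin 4) : ℝ :=
  α * (form1 i j * form1 k l) + β * (form1 i j * form2 c k l + form2 c i j * form1 k l)
    - τ / 12 * (form1 i j * form3 a b c k l + form2 c i j * form2 c k l
      + form3 a b c i j * form1 k l)

lemma sdTensor_swap_fst (a b c τ α β : ℝ) (i j k l : Fin 4) :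
    sdTensor a b c τ α β j i k l = -sdTensor a b c τ α β i j k l := by
  simp only [sdTensor, form1, form2, form3, skew_swap _ _ _ _ _ _ i j]
  ring

lemma sdTensor_swap_snd (a b c τ α β : ℝ) (i j k l : Fin 4) :
    sdTensor a b c τ α β i j l k = -sdTensor a b c τ α β i j k l := by
  simp only [sdTensor, form1, form2, form3, skew_swap _ _ _ _ _ _ k l]
  ring

/-- The curvature of an Einstein self-dual Walker metric. By the symmetries it is enough to compare
components; only the one in the plane of `∂₃` and `∂₄` involves `W⁺₁₁`. -/
lemma riem_of_einsteinSelfDual (h : SmoothWalker D a b c) (hx : x ∈ D) {τ : ℝ}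
    (hE : EinsteinSelfDualAt a b c τ x) (i j k l : Fin 4) :
    riem (walker a b c) i j k l x =
      τ / 12 * (walker a b c x i k * walker a b c x j l - walker a b c x j k * walker a b c x i l)
      + sdTensor (a x) (b x) (c x) τ ((w11Expr a b c x + τ / 12) / 2) (-w12Expr a b c x / 2)
        i j k l := by
  have hR := riem_walker_components h hx
  obtain ⟨-, -, -, -, -, -, -, h22, h23, h33⟩ := ricci_walker_components h hx
  obtain ⟨a00, a01, a11, b00, b01, b11, c00, c01, c11⟩ := hE.second_derivatives h hx
  have e22 := h22.symm.trans (hE.ricci_eq 2 2)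
  have e23 := h23.symm.trans (hE.ricci_eq 2 3)
  have e33 := h33.symm.trans (hE.ricci_eq 3 3)
  simp [walker, a00, a01, a11, b00, b01, b11, c00, c01, c11] at e22 e23 e33
  let T : Fin 4 → Fin 4 → Fin 4 → Fin 4 → ℝ := fun i j k l =>
    τ / 12 * (walker a b c x i k * walker a b c x j l - walker a b c x j k * walker a b c x i l)
      + sdTensor (a x) (b x) (c x) τ ((w11Expr a b c x + τ / 12) / 2) (-w12Expr a b c x / 2)
        i j k l
  change riem (walker a b c) i j k l x = T i j k l
  have hT1 : ∀ i j k l, T j i k l = -T i j k l := fun i j k l => by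
    simp only [T, sdTensor_swap_fst _ _ _ _ _ _ i j]
    ring
  have hT2 : ∀ i j k l, T i j l k = -T i j k l := fun i j k l => by
    simp only [T, sdTensor_swap_snd _ _ _ _ _ _ _ _ k l]
    ring
  rw [← sub_eq_zero]
  refine eq_zero_of_antisymm (F := fun i j => riem (walker a b c) i j k l x - T i j k l)
    (fun i j => ?_) ?_ ?_ ?_ ?_ ?_ ?_ i j
  · rw [riem_swap_fst _ i j, hT1 i j]
    ring
  all_goals
    refine eq_zero_of_antisymm (F := fun k l => riem (walker a b c) _ _ k l x - T _ _ k l)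
      (fun k l => ?_) ?_ ?_ ?_ ?_ ?_ ?_ k l
    · rw [riem_swap_snd h hx _ _ k l, hT2 _ _ k l]
      ring
    all_goals
      simp [riem_pair_symm_of_lt h hx, riem_pair_symm_of_lt' h hx, hR, T, walker, sdTensor, form1,
        form2, form3, skew, a00, a01, a11, b00, b01, b11, c00, c01, c11, w11Expr, w12Expr]
    -- The components with one index pair `(2, 3)` need one Einstein equation each, and the
    -- component with both pairs equal to `(2, 3)` needs all three of them.
    all_goals first
      | ring1
      | linear_combination (1 / 2) * e22
      | linear_combination (-1 / 2) * e22
      | linear_combination (1 / 2) * e33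
      | linear_combination (-1 / 2) * e33
      | linear_combination (1 / 2) * e23
      | linear_combination (-1 / 2) * e23
      | linear_combination (b x / 2) * e22 - (c x) * e23 + (a x / 2) * e33

lemma EinsteinSelfDualAt.scal_eq (h : SmoothWalker D a b c) (hx : x ∈ D) {τ : ℝ}
    (hE : EinsteinSelfDualAt a b c τ x) : scal (walker a b c) x = τ := by
  obtain ⟨a00, -, -, -, -, b11, -, c01, -⟩ := hE.second_derivatives h hx
  rw [scal_walker h hx, a00, b11, c01]
  ring

/-- The Weyl tensor is `sdTensor`, and each of `form1`, `form2`, `form3` equals its Hodge star. -/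
lemma weylMinus_of_einsteinSelfDual (h : SmoothWalker D a b c) (hx : x ∈ D) {τ : ℝ}
    (hE : EinsteinSelfDualAt a b c τ x) (i j k l : Fin 4) :
    weylMinus (walker a b c) i j k l x = 0 := by
  have hw : ∀ i j k l, weyl (walker a b c) i j k l x =
      sdTensor (a x) (b x) (c x) τ ((w11Expr a b c x + τ / 12) / 2) (-w12Expr a b c x / 2)
        i j k l := fun i j k l => by
    rw [weyl, riem_of_einsteinSelfDual h hx hE, hE.scal_eq h hx]
    simp only [hE.ricci_eq]
    ring
  rw [weylMinus, starWeyl_eq_starForm]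
  simp only [hw]
  rw [starForm_walker (fun i j => sdTensor_swap_fst _ _ _ _ _ _ i j k l)]
  fin_cases i <;> fin_cases j <;>
  · simp [skew, sdTensor, form1, form2, form3]
    try ring

/-! ### The Jacobi operator in an adapted basis -/

/-- The vector metrically dual to `F(X, ·)`. -/
noncomputable def contract (g : MetricField) (x : Fin 4 → ℝ) (F : Matrix (Fin 4) (Fin 4) ℝ)
    (X : Fin 4 → ℝ) (l : Fin 4) : ℝ :=
  ∑ k, ∑ m, X k * F k m * (g x)⁻¹ m l

/-- The value `F(X, Y)` of a bilinear form. -/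
noncomputable def pair (F : Matrix (Fin 4) (Fin 4) ℝ) (X Y : Fin 4 → ℝ) : ℝ :=
  ∑ i, ∑ j, X i * F i j * Y j

lemma jacobi_mulVec (X Y : Fin 4 → ℝ) (l : Fin 4) :
    (jacobi (walker a b c) x X).mulVec Y l =
      ∑ i, ∑ j, ∑ k, ∑ m, X i * X k * Y j * (walker a b c x)⁻¹ m l
        * riem (walker a b c) i j k m x := by
  simp only [Matrix.mulVec, dotProduct, jacobi, Matrix.of_apply,
    curv_eq_sum (isUnit_walker_det a b c x), Finset.mul_sum, Finset.sum_mul]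
  rw [Finset.sum_comm]
  refine Finset.sum_congr rfl fun i _ => Finset.sum_congr rfl fun j _ =>
    Finset.sum_congr rfl fun k _ => Finset.sum_congr rfl fun m _ => ?_
  ring

lemma sum_mul_form_mul_form (g : MetricField) (F G : Matrix (Fin 4) (Fin 4) ℝ) (X Y : Fin 4 → ℝ)
    (l : Fin 4) : ∑ i, ∑ j, ∑ k, ∑ m, X i * X k * Y j * (g x)⁻¹ m l * (F i j * G k m) =
      pair F X Y * contract g x G X l := by
  simp only [pair, Finset.sum_mul]
  refine Finset.sum_congr rfl fun i _ => Finset.sum_congr rfl fun j _ => ?_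
  simp only [contract, Finset.mul_sum]
  refine Finset.sum_congr rfl fun k _ => Finset.sum_congr rfl fun m _ => ?_
  ring

/-- The Jacobi operator of the curvature tensor of constant sectional curvature one. -/
lemma sum_mul_constant_curvature (X Y : Fin 4 → ℝ) (l : Fin 4) :
    ∑ i, ∑ j, ∑ k, ∑ m, X i * X k * Y j * (walker a b c x)⁻¹ m l *
      (walker a b c x i k * walker a b c x j m - walker a b c x j k * walker a b c x i m) =
    inner (walker a b c) x X X * Y l - inner (walker a b c) x X Y * X l := by
  have h' : ∀ n, ∑ m, walker a b c x n m * (walker a b c x)⁻¹ m l = if n = l then 1 else 0 :=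
    fun n => by
      have := congrFun (congrFun (Matrix.mul_nonsing_inv _ (isUnit_walker_det a b c x)) n) l
      rwa [Matrix.mul_apply, Matrix.one_apply] at this
  have h1 : ∀ i j k, ∑ m, X i * X k * Y j * (walker a b c x)⁻¹ m l *
      (walker a b c x i k * walker a b c x j m - walker a b c x j k * walker a b c x i m) =
      X i * X k * Y j * (walker a b c x i k * (if j = l then 1 else 0)
        - walker a b c x j k * (if i = l then 1 else 0)) := fun i j k => by
    rw [← h', ← h', Finset.mul_sum, Finset.mul_sum, ← Finset.sum_sub_distrib, Finset.mul_sum]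
    exact Finset.sum_congr rfl fun m _ => by ring
  simp only [h1, inner, Fin.sum_univ_four]
  fin_cases l <;>
  · simp [walker]
    ring

/-- `R_X Y` in terms of the vectors `Aᵢ X` and the scalars `formᵢ (X, Y) = g(Aᵢ X, Y)`. -/
lemma jacobi_mulVec_of_einsteinSelfDual (h : SmoothWalker D a b c) (hx : x ∈ D) {τ : ℝ}
    (hE : EinsteinSelfDualAt a b c τ x) (X Y : Fin 4 → ℝ) (l : Fin 4) :
    let α := (w11Expr a b c x + τ / 12) / 2
    let β := -w12Expr a b c x / 2
    let v1 := contract (walker a b c) x form1 X l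
    let v2 := contract (walker a b c) x (form2 (c x)) X l
    let v3 := contract (walker a b c) x (form3 (a x) (b x) (c x)) X l
    let p1 := pair form1 X Y
    let p2 := pair (form2 (c x)) X Y
    let p3 := pair (form3 (a x) (b x) (c x)) X Y
    (jacobi (walker a b c) x X).mulVec Y l =
      τ / 12 * (inner (walker a b c) x X X * Y l - inner (walker a b c) x X Y * X l)
        + α * (p1 * v1) + β * (p1 * v2 + p2 * v1) - τ / 12 * (p1 * v3 + p2 * v2 + p3 * v1) := by
  intro α β v1 v2 v3 p1 p2 p3
  rw [jacobi_mulVec]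
  simp only [riem_of_einsteinSelfDual h hx hE, v1, v2, v3, p1, p2, p3,
    ← sum_mul_form_mul_form, ← sum_mul_constant_curvature, Finset.mul_sum,
    ← Finset.sum_add_distrib, ← Finset.sum_sub_distrib]
  refine Finset.sum_congr rfl fun i _ => Finset.sum_congr rfl fun j _ =>
    Finset.sum_congr rfl fun k _ => Finset.sum_congr rfl fun m _ => ?_
  rw [sdTensor]
  ring

lemma contract_form1 (X : Fin 4 → ℝ) :
    contract (walker a b c) x form1 X = ![-X 3, X 2, 0, 0] := by
  funext l
  fin_cases l <;>
  · simp [contract, form1, skew, Fin.sum_univ_four, walker_inv]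

lemma contract_form2 (X : Fin 4 → ℝ) : contract (walker a b c) x (form2 (c x)) X =
    ![-X 0 - a x * X 2 - 2 * c x * X 3, -X 1 - b x * X 3, X 2, X 3] := by
  funext l
  fin_cases l <;>
  · simp [contract, form2, skew, Fin.sum_univ_four, walker_inv]
    try ring

lemma contract_form3 (X : Fin 4 → ℝ) :
    contract (walker a b c) x (form3 (a x) (b x) (c x)) X =
    ![a x / 2 * X 1 + a x * b x / 4 * X 3 - c x * (X 0 + a x / 2 * X 2 + c x * X 3),
      -(b x / 2 * X 0) - a x * b x / 4 * X 2 - b x * c x / 2 * X 3,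
      -X 1 - b x / 2 * X 3, X 0 + a x / 2 * X 2 + c x * X 3] := by
  funext l
  fin_cases l <;>
  · simp [contract, form3, skew, Fin.sum_univ_four, walker_inv]
    try ring

/-- The matrix with columns `X`, `A₁X`, `A₂X`, `A₃X`, where `Aᵢ` is the skew endomorphism dual to
the self-dual form `formᵢ`. -/
noncomputable def adaptedBasis (a b c : (Fin 4 → ℝ) → ℝ) (x X : Fin 4 → ℝ) :
    Matrix (Fin 4) (Fin 4) ℝ :=
  (Matrix.of ![X, contract (walker a b c) x form1 X, contract (walker a b c) x (form2 (c x)) X,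
    contract (walker a b c) x (form3 (a x) (b x) (c x)) X]).transpose

/-- The shape of the matrix of a Jacobi operator in the adapted basis. -/
def modelJacobi (t p q r : ℝ) : Matrix (Fin 4) (Fin 4) ℝ :=
  !![0, 0, 0, 0; 0, t, p, q; 0, 0, 4 * t, r; 0, 0, 0, t]

lemma det_adaptedBasis (X : Fin 4 → ℝ) :
    (adaptedBasis a b c x X).det = inner (walker a b c) x X X ^ 2 / 2 := by
  rw [adaptedBasis, Matrix.det_transpose, det_fin_four, contract_form1, contract_form2,
    contract_form3]
  simp [inner, walker, Fin.sum_univ_four]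
  ring

/-- The vectors `A₁X`, `A₂X`, `A₃X` are orthogonal to `X`. -/
lemma inner_contract (X : Fin 4 → ℝ) :
    inner (walker a b c) x X (contract (walker a b c) x form1 X) = 0 ∧
    inner (walker a b c) x X (contract (walker a b c) x (form2 (c x)) X) = 0 ∧
    inner (walker a b c) x X (contract (walker a b c) x (form3 (a x) (b x) (c x)) X) = 0 := by
  rw [contract_form1, contract_form2, contract_form3]
  refine ⟨?_, ?_, ?_⟩ <;>
  · simp [inner, walker, Fin.sum_univ_four]
    ring

lemma pair_skew (p01 p02 p03 p12 p13 p23 : ℝ) (X Y : Fin 4 → ℝ) :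
    pair (skew p01 p02 p03 p12 p13 p23) X Y = p01 * (X 0 * Y 1 - X 1 * Y 0)
      + p02 * (X 0 * Y 2 - X 2 * Y 0) + p03 * (X 0 * Y 3 - X 3 * Y 0)
      + p12 * (X 1 * Y 2 - X 2 * Y 1) + p13 * (X 1 * Y 3 - X 3 * Y 1)
      + p23 * (X 2 * Y 3 - X 3 * Y 2) := by
  simp [pair, skew, Fin.sum_univ_four]
  ring

lemma pair_skew_self (p01 p02 p03 p12 p13 p23 : ℝ) (X : Fin 4 → ℝ) :
    pair (skew p01 p02 p03 p12 p13 p23) X X = 0 := by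
  rw [pair_skew]
  ring

/-- The Gram matrix of `A₁X`, `A₂X`, `A₃X`: it is `g(X, X) / 2` times that of the self-dual forms. -/
lemma pair_contract (X : Fin 4 → ℝ) :
    let ε := inner (walker a b c) x X X
    let f2 := form2 (c x)
    let f3 := form3 (a x) (b x) (c x)
    let v1 := contract (walker a b c) x form1 X
    let v2 := contract (walker a b c) x f2 X
    let v3 := contract (walker a b c) x f3 X
    (pair form1 X v1 = 0 ∧ pair form1 X v2 = 0 ∧ pair form1 X v3 = ε / 2) ∧
    (pair f2 X v1 = 0 ∧ pair f2 X v2 = -ε ∧ pair f2 X v3 = 0) ∧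
    (pair f3 X v1 = ε / 2 ∧ pair f3 X v2 = 0 ∧ pair f3 X v3 = 0) := by
  intro ε f2 f3 v1 v2 v3
  simp only [ε, f2, f3, v1, v2, v3, contract_form1, contract_form2, contract_form3]
  refine ⟨⟨?_, ?_, ?_⟩, ⟨?_, ?_, ?_⟩, ⟨?_, ?_, ?_⟩⟩ <;>
  · simp only [form1, form2, form3, pair_skew]
    simp [inner, walker, Fin.sum_univ_four]
    try ring

lemma jacobi_mul_adaptedBasis (h : SmoothWalker D a b c) (hx : x ∈ D) {τ : ℝ}
    (hE : EinsteinSelfDualAt a b c τ x) {ε : ℝ} {X : Fin 4 → ℝ}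
    (hX : inner (walker a b c) x X X = ε) :
    jacobi (walker a b c) x X * adaptedBasis a b c x X = adaptedBasis a b c x X *
      modelJacobi (ε * (τ / 24)) (ε * w12Expr a b c x / 2)
        (ε * (w11Expr a b c x + τ / 12) / 4) (-(ε * w12Expr a b c x / 4)) := by
  have hcol : ∀ m, (fun l => adaptedBasis a b c x X l m) = ![X,
      contract (walker a b c) x form1 X, contract (walker a b c) x (form2 (c x)) X,
      contract (walker a b c) x (form3 (a x) (b x) (c x)) X] m := fun m => rfl
  ext l m
  have : (jacobi (walker a b c) x X * adaptedBasis a b c x X) l m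
      = (jacobi (walker a b c) x X).mulVec (fun l => adaptedBasis a b c x X l m) l := rfl
  rw [this, hcol, jacobi_mulVec_of_einsteinSelfDual h hx hE, hX]
  obtain ⟨⟨h11, h12, h13⟩, ⟨h21, h22, h23⟩, ⟨h31, h32, h33⟩⟩ := pair_contract (a := a) (b := b)
    (c := c) (x := x) X
  obtain ⟨o1, o2, o3⟩ := inner_contract (a := a) (b := b) (c := c) (x := x) X
  have s1 : pair form1 X X = 0 := pair_skew_self _ _ _ _ _ _ X
  have s2 : pair (form2 (c x)) X X = 0 := pair_skew_self _ _ _ _ _ _ X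
  have s3 : pair (form3 (a x) (b x) (c x)) X X = 0 := pair_skew_self _ _ _ _ _ _ X
  fin_cases m <;>
  · simp [Matrix.mul_apply, Fin.sum_univ_four, adaptedBasis, modelJacobi, h11, h12, h13, h21, h22,
      h23, h31, h32, h33, o1, o2, o3, s1, s2, s3, hX]
    try ring

lemma isConj_of_mul_eq_mul {A B : Matrix (Fin 4) (Fin 4) ℝ} (P : Matrix (Fin 4) (Fin 4) ℝ)
    (hP : P.det ≠ 0) (h : A * P = P * B) :
    IsConj A B :=
  isConj_comm.1 ⟨((Matrix.isUnit_iff_isUnit_det _).2 hP.isUnit).unit, h.symm⟩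

/-- The similarity class of a Jacobi operator of an Einstein self-dual Walker metric depends only on
`g(X, X)`, the scalar curvature, `W⁺₁₁` and `W⁺₁₂`. -/
lemma isConj_modelJacobi (h : SmoothWalker D a b c) (hx : x ∈ D) {τ : ℝ}
    (hE : EinsteinSelfDualAt a b c τ x) {ε : ℝ} (hε : ε ≠ 0) {X : Fin 4 → ℝ}
    (hX : inner (walker a b c) x X X = ε) :
    IsConj (jacobi (walker a b c) x X)
      (modelJacobi (ε * (τ / 24)) (ε * w12Expr a b c x / 2)
        (ε * (w11Expr a b c x + τ / 12) / 4) (-(ε * w12Expr a b c x / 4))) := by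
  refine isConj_of_mul_eq_mul (adaptedBasis a b c x X) ?_ (jacobi_mul_adaptedBasis h hx hE hX)
  rw [det_adaptedBasis, hX]
  exact div_ne_zero (pow_ne_zero 2 hε) two_ne_zero

/-! ### Similarity invariants of the model matrix -/

section LinearAlgebra

open Polynomial

variable {A B : Matrix (Fin 4) (Fin 4) ℝ}

lemma exists_eq_conj (h : IsConj A B) : ∃ u : (Matrix (Fin 4) (Fin 4) ℝ)ˣ,
    B = u.val * A * u⁻¹.val := by
  obtain ⟨u, hu⟩ := h
  exact ⟨u, (Units.eq_mul_inv_iff_mul_eq u).2 hu.eq.symm⟩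

lemma charpoly_eq_of_isConj (h : IsConj A B) : A.charpoly = B.charpoly := by
  obtain ⟨u, rfl⟩ := exists_eq_conj h
  rw [Matrix.coe_units_inv]
  exact (Matrix.charpoly_units_conj u A).symm

lemma pow_eq_zero_iff_of_isConj (h : IsConj A B) (n : ℕ) : A ^ n = 0 ↔ B ^ n = 0 := by
  obtain ⟨u, rfl⟩ := exists_eq_conj h
  rw [Units.conj_pow, Units.mul_left_eq_zero, Units.mul_right_eq_zero]

lemma aeval_eq_zero_iff_of_isConj (h : IsConj A B) (f : ℝ[X]) :
    aeval A f = 0 ↔ aeval B f = 0 := by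
  obtain ⟨u, rfl⟩ := exists_eq_conj h
  have : aeval (u.val * A * u⁻¹.val) f = u.val * aeval A f * u⁻¹.val := by
    induction f using Polynomial.induction_on' with
    | add p q hp hq => simp only [map_add, hp, hq, mul_add, add_mul]
    | monomial n r =>
      simp only [aeval_monomial, Units.conj_pow, Algebra.algebraMap_eq_smul_one, smul_mul_assoc,
        mul_smul_comm, one_mul]
  rw [this, Units.mul_left_eq_zero, Units.mul_right_eq_zero]

variable {t p q r : ℝ}

lemma modelJacobi_charpoly (t p q r : ℝ) :
    (modelJacobi t p q r).charpoly = X * (X - C (4 * t)) * (X - C t) ^ 2 := by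
  rw [Matrix.charpoly_of_isUpperTriangular]
  · simp [Fin.prod_univ_four, modelJacobi]
    ring
  · intro i j hij
    fin_cases i <;> fin_cases j <;> first | rfl | exact absurd hij (by decide)

lemma isDiagonalizable_of_isConj (h : IsConj A B) : IsDiagonalizable A ↔ IsDiagonalizable B :=
  ⟨fun ⟨d, hd⟩ => ⟨d, (isConj_comm.1 h).trans hd⟩, fun ⟨d, hd⟩ => ⟨d, h.trans hd⟩⟩

/-- The model matrix is diagonalizable if and only if it is a root of `X (X - t) (X - 4t)`, and the
entry `(1, 3)` of the value of this polynomial is the only one that can be nonzero. -/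
lemma modelJacobi_isDiagonalizable_iff (ht : t ≠ 0) :
    IsDiagonalizable (modelJacobi t p q r) ↔ 3 * t * q - p * r = 0 := by
  constructor
  · rintro ⟨d, hd⟩
    have hdi : ∀ i, d i * (d i - t) * (d i - 4 * t) = 0 := fun i => by
      have h1 := congrArg (eval (d i)) (charpoly_eq_of_isConj hd)
      rw [modelJacobi_charpoly, Matrix.charpoly_diagonal, eval_prod,
        Finset.prod_eq_zero (Finset.mem_univ i) (by simp)] at h1
      simp only [eval_mul, eval_X, eval_sub, eval_C, eval_pow] at h1
      have h2 : (d i * (d i - t) * (d i - 4 * t)) ^ 2 = 0 := by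
        linear_combination (d i * (d i - 4 * t)) * h1
      exact pow_eq_zero_iff two_ne_zero |>.1 h2
    have h0 := (aeval_eq_zero_iff_of_isConj hd (X * (X - C t) * (X - C (4 * t)))).2 (by
      simp only [map_mul, aeval_X, map_sub, aeval_C, Matrix.algebraMap_eq_diagonal,
        Matrix.diagonal_sub, Matrix.diagonal_mul_diagonal]
      ext i j
      simp [Matrix.diagonal_apply, Pi.algebraMap_apply, hdi])
    have h13 := congrFun (congrFun h0 1) 3
    -- The entry in question is `-t * (3 * t * q - p * r)`.
    simp only [map_mul, aeval_X, map_sub, aeval_C, Matrix.mul_apply, Matrix.sub_apply,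
      Matrix.algebraMap_matrix_apply, Fin.sum_univ_four] at h13
    simp [modelJacobi] at h13
    have : t * (3 * t * q - p * r) = 0 := by linear_combination -h13
    exact (mul_eq_zero.1 this).resolve_left ht
  · intro h
    -- The columns are eigenvectors; the last one is an eigenvector by the vanishing of `3tq - pr`.
    refine ⟨![0, t, 4 * t, t], isConj_of_mul_eq_mul
      !![1, 0, 0, 0; 0, 1, p, 0; 0, 0, 3 * t, -r; 0, 0, 0, 3 * t] ?_ ?_⟩
    · simp [Matrix.det_succ_row_zero, Fin.sum_univ_succ, Fin.succAbove, ht]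
    · ext i j
      fin_cases i <;> fin_cases j <;>
        simp [modelJacobi, Matrix.mul_apply, Fin.sum_univ_four, Matrix.diagonal_apply] <;>
        first
        | ring1
        | linear_combination h

/-- With the columns of the matrix below as a basis, the last eigenvector of the diagonalizable
case becomes a generalized eigenvector. -/
lemma modelJacobi_isConj_jordan (ht : t ≠ 0) (hk : 3 * t * q - p * r ≠ 0) :
    IsConj (modelJacobi t p q r) (modelJacobi t 0 1 0) := by
  refine isConj_of_mul_eq_mul !![1, 0, 0, 0; 0, 3 * t * q - p * r, p, 0; 0, 0, 3 * t, -r;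
    0, 0, 0, 3 * t] ?_ ?_
  · simp [Matrix.det_succ_row_zero, Fin.sum_univ_succ, Fin.succAbove, ht, hk]
  · ext i j
    fin_cases i <;> fin_cases j <;>
    · simp [modelJacobi, Matrix.mul_apply, Fin.sum_univ_four]
      try ring

/-- A polynomial in a Jordan block of size two has its value and derivative as entries. -/
lemma aeval_modelJacobi_apply (t : ℝ) (f : ℝ[X]) :
    aeval (modelJacobi t 0 1 0) f 1 1 = f.eval t ∧
    aeval (modelJacobi t 0 1 0) f 1 3 = f.derivative.eval t := by
  induction f using Polynomial.induction_on' with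
  | add p q hp hq => simp [hp.1, hp.2, hq.1, hq.2]
  | monomial n s =>
    have h : ∀ n : ℕ, (modelJacobi t 0 1 0 ^ n) 1 0 = 0 ∧ (modelJacobi t 0 1 0 ^ n) 1 1 = t ^ n ∧
        (modelJacobi t 0 1 0 ^ n) 1 2 = 0 ∧ (modelJacobi t 0 1 0 ^ n) 1 3 = n * t ^ (n - 1) := by
      intro n
      induction n with
      | zero => simp
      | succ n ih =>
        obtain ⟨h0, h1, h2, h3⟩ := ih
        simp only [pow_succ (modelJacobi t 0 1 0), Matrix.mul_apply, Fin.sum_univ_four, h0, h1, h2,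
          h3]
        refine ⟨by simp [modelJacobi], by simp [modelJacobi, pow_succ], by simp [modelJacobi], ?_⟩
        rcases n with _ | n
        · simp [modelJacobi]
        · simp [modelJacobi, pow_succ]
          ring
    obtain ⟨-, h1, -, h3⟩ := h n
    simp only [aeval_monomial, Algebra.algebraMap_eq_smul_one, smul_mul_assoc, one_mul,
      Matrix.smul_apply, h1, h3, smul_eq_mul, eval_monomial, derivative_monomial]
    exact ⟨trivial, by ring⟩

lemma rootMultiplicity_minpoly_of_isConj (ht : t ≠ 0) (h : IsConj A (modelJacobi t 0 1 0)) :
    (minpoly ℝ A).rootMultiplicity t = 2 := by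
  have hm : minpoly ℝ A ≠ 0 := minpoly.ne_zero (Matrix.isIntegral A)
  refine le_antisymm ?_ ?_
  · have hc : A.charpoly = X * (X - C (4 * t)) * (X - C t) ^ 2 := by
      rw [charpoly_eq_of_isConj h, modelJacobi_charpoly]
    have hc0 : X * (X - C (4 * t)) * (X - C t) ^ 2 ≠ 0 := by
      rw [← hc]
      exact (Matrix.charpoly_monic A).ne_zero
    refine (rootMultiplicity_le_rootMultiplicity_of_dvd (hc ▸ hc0)
      (Matrix.minpoly_dvd_charpoly A) t).trans ?_
    rw [hc, rootMultiplicity_mul hc0, rootMultiplicity_X_sub_C_pow, rootMultiplicity_eq_zero]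
    simp only [IsRoot, eval_mul, eval_X, eval_sub, eval_C, mul_eq_zero, not_or]
    exact ⟨ht, fun h => ht (by linarith)⟩
  · have h0 := (aeval_eq_zero_iff_of_isConj h _).1 (minpoly.aeval ℝ A)
    obtain ⟨h1, h3⟩ := aeval_modelJacobi_apply t (minpoly ℝ A)
    rw [h0] at h1 h3
    exact (one_lt_rootMultiplicity_iff_isRoot hm).2 ⟨h1.symm, h3.symm⟩

lemma modelJacobi_zero_eq_zero_iff : modelJacobi 0 p q r = 0 ↔ p = 0 ∧ q = 0 ∧ r = 0 := by
  constructor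
  · intro h
    exact ⟨congrFun (congrFun h 1) 2, congrFun (congrFun h 1) 3, congrFun (congrFun h 2) 3⟩
  · rintro ⟨rfl, rfl, rfl⟩
    ext i j
    fin_cases i <;> fin_cases j <;> simp [modelJacobi]

lemma modelJacobi_zero_sq : modelJacobi 0 p q r ^ 2 = 0 ↔ p * r = 0 := by
  constructor
  · intro h
    have := congrFun (congrFun h 1) 3
    simpa [modelJacobi, pow_two, Matrix.mul_apply, Fin.sum_univ_four] using this
  · intro h
    ext i j
    fin_cases i <;> fin_cases j <;>
      simp [modelJacobi, pow_two, Matrix.mul_apply, Fin.sum_univ_four, -mul_eq_zero, h]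

lemma modelJacobi_zero_cube : modelJacobi 0 p q r ^ 3 = 0 := by
  ext i j
  fin_cases i <;> fin_cases j <;>
    simp [modelJacobi, pow_succ, Matrix.mul_apply, Fin.sum_univ_four]

end LinearAlgebra

/-! ### Pointwise Osserman metrics are Einstein -/

lemma trace_jacobi (g : MetricField) (X : Fin 4 → ℝ) :
    (jacobi g x X).trace = ∑ i, ∑ k, X i * X k * ricci g i k x := by
  simp only [Matrix.trace, Matrix.diag, jacobi, Matrix.of_apply, ricci, Finset.mul_sum]
  rw [Finset.sum_comm]
  exact Finset.sum_congr rfl fun i _ => Finset.sum_comm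

lemma trace_eq_of_charpoly_eq {A B : Matrix (Fin 4) (Fin 4) ℝ} (h : A.charpoly = B.charpoly) :
    A.trace = B.trace := by
  rw [Matrix.trace_eq_neg_charpoly_coeff, Matrix.trace_eq_neg_charpoly_coeff, h]

/-- The trace of the Jacobi operator of `X` is `ρ(X, X)`, so that for a pointwise Osserman metric
the Ricci form is constant on unit spacelike vectors. Finitely many such vectors determine it. -/
lemma exists_ricci_eq_of_osserman (h : SmoothWalker D a b c) (hx : x ∈ D)
    (hO : IsPointwiseOsserman (walker a b c) D) :
    ∃ τ : ℝ, ∀ i j, ricci (walker a b c) i j x = τ / 4 * walker a b c x i j := by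
  have hs := ricci_symm h hx
  obtain ⟨h00, h01, -, -, h11, -⟩ := ricci_walker_components h hx
  set ρ := fun i j => ricci (walker a b c) i j x with hρ
  obtain ⟨l, hl⟩ : ∃ l : ℝ, ∀ X : Fin 4 → ℝ, inner (walker a b c) x X X = 1 →
      (jacobi (walker a b c) x X).trace = l := by
    refine ⟨(jacobi (walker a b c) x ![(1 - a x) / 2, 0, 1, 0]).trace, fun X hX =>
      trace_eq_of_charpoly_eq (hO x hx 1 (Or.inl rfl) X _ hX ?_)⟩
    simp [inner, walker, Fin.sum_univ_four]
    ring
  have key : ∀ X0 X1 X2 X3 : ℝ, 2 * X0 * X2 + 2 * X1 * X3 + a x * X2 ^ 2 + b x * X3 ^ 2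
      + 2 * c x * X2 * X3 = 1 →
      2 * (ρ 0 2 * X0 * X2 + ρ 0 3 * X0 * X3 + ρ 1 2 * X1 * X2 + ρ 1 3 * X1 * X3 + ρ 2 3 * X2 * X3)
        + ρ 2 2 * X2 ^ 2 + ρ 3 3 * X3 ^ 2 = l := by
    intro X0 X1 X2 X3 hX
    have := hl ![X0, X1, X2, X3] (by
      rw [← hX]
      simp [inner, walker, Fin.sum_univ_four]
      ring)
    rw [trace_jacobi] at this
    simp [Fin.sum_univ_four, h00, h01, h11, hs 0 1, hs 0 2, hs 0 3, hs 1 2, hs 1 3, hs 2 3] at this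
    simp only [hρ]
    linarith
  -- The vectors `(X₁, w, m, 0)` and `(w, X₂, 0, m)` with `m = 1, 2` and `w = 0, 1` determine all
  -- components except `ρ₃₄`, for which one more vector is used.
  have k1 := key ((1 - a x) / 2) 0 1 0 (by ring)
  have k2 := key ((1 - a x) / 2) 1 1 0 (by ring)
  have k3 := key ((1 - 4 * a x) / 4) 0 2 0 (by ring)
  have k4 := key 0 ((1 - b x) / 2) 0 1 (by ring)
  have k5 := key 1 ((1 - b x) / 2) 0 1 (by ring)
  have k6 := key 0 ((1 - 4 * b x) / 4) 0 2 (by ring)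
  have r12 : ρ 1 2 = 0 := by linear_combination (1 / 2) * k2 - (1 / 2) * k1
  have r03 : ρ 0 3 = 0 := by linear_combination (1 / 2) * k5 - (1 / 2) * k4
  have r02 : ρ 0 2 = l := by linear_combination (4 / 3) * k1 - (1 / 3) * k3
  have r13 : ρ 1 3 = l := by linear_combination (4 / 3) * k4 - (1 / 3) * k6
  have r22 : ρ 2 2 = l * a x := by linear_combination k1 - (1 - a x) * r02
  have r33 : ρ 3 3 = l * b x := by linear_combination k4 - (1 - b x) * r13
  have k7 := key ((1 - a x - b x - 2 * c x) / 2) 0 1 1 (by ring)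
  have r23 : ρ 2 3 = l * c x := by
    linear_combination (1 / 2) * k7 - ((1 - a x - b x - 2 * c x) / 2) * (r02 + r03)
      - (1 / 2) * r22 - (1 / 2) * r33
  refine ⟨4 * l, fun i j => ?_⟩
  simp only [hρ] at r12 r03 r02 r13 r22 r33 r23
  fin_cases i <;> fin_cases j <;>
    simp [walker, h00, h01, h11, hs 0 1, hs 0 2, hs 0 3, hs 1 2, hs 1 3, hs 2 3, r12, r03, r02, r13,
      r22, r33, r23]

lemma exists_einsteinSelfDualAt (h : SmoothWalker D a b c)
    (hO : IsPointwiseOsserman (walker a b c) D) (hS : IsSelfDual (walker a b c) D) (hx : x ∈ D) :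
    ∃ τ, EinsteinSelfDualAt a b c τ x :=
  (exists_ricci_eq_of_osserman h hx hO).imp fun _ hτ =>
    ⟨hτ, selfDualEqs_of_weylMinus h hx (hS x hx)⟩

lemma isPointwiseOsserman_of_einsteinSelfDual (h : SmoothWalker D a b c)
    (hE : ∀ x ∈ D, ∃ τ, EinsteinSelfDualAt a b c τ x) :
    IsPointwiseOsserman (walker a b c) D := by
  intro x hx ε hε X Y hX hY
  obtain ⟨τ, hτ⟩ := hE x hx
  have hε0 : ε ≠ 0 := by rcases hε with rfl | rfl <;> norm_num
  rw [charpoly_eq_of_isConj (isConj_modelJacobi h hx hτ hε0 hX),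
    charpoly_eq_of_isConj (isConj_modelJacobi h hx hτ hε0 hY)]

lemma isSelfDual_of_einsteinSelfDual (h : SmoothWalker D a b c)
    (hE : ∀ x ∈ D, ∃ τ, EinsteinSelfDualAt a b c τ x) : IsSelfDual (walker a b c) D := by
  intro x hx i j k l
  obtain ⟨τ, hτ⟩ := hE x hx
  exact weylMinus_of_einsteinSelfDual h hx hτ i j k l

/-! ### Functions of `(x₃, x₄)` -/

lemma hasFDerivAt_proj (x : Fin 4 → ℝ) : HasFDerivAt proj
    ((ContinuousLinearMap.proj (R := ℝ) (φ := fun _ : Fin 4 => ℝ) 2).prod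
      (ContinuousLinearMap.proj 3)) x :=
  ((ContinuousLinearMap.proj (R := ℝ) (φ := fun _ : Fin 4 => ℝ) 2).prod
    (ContinuousLinearMap.proj 3)).hasFDerivAt

lemma contDiff_proj : ContDiff ℝ ∞ proj :=
  ((ContinuousLinearMap.proj (R := ℝ) (φ := fun _ : Fin 4 => ℝ) 2).prod
    (ContinuousLinearMap.proj 3)).contDiff

lemma pd_comp_proj {f : ℝ × ℝ → ℝ} (hf : DifferentiableAt ℝ f (proj x)) :
    pd 0 (fun y => f (proj y)) x = 0 ∧ pd 1 (fun y => f (proj y)) x = 0 ∧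
    pd 2 (fun y => f (proj y)) x = d3 f (proj x) ∧
    pd 3 (fun y => f (proj y)) x = d4 f (proj x) := by
  have h := (hf.hasFDerivAt.comp x (hasFDerivAt_proj x)).fderiv
  have h' : ∀ i, pd i (fun y => f (proj y)) x = fderiv ℝ f (proj x)
      ((Pi.single i (1 : ℝ) : Fin 4 → ℝ) 2, (Pi.single i (1 : ℝ) : Fin 4 → ℝ) 3) := fun i => by
    rw [pd]
    exact congrArg (fun L => L (Pi.single i 1)) h
  simp only [h', d3, d4]
  simp [show ((0 : ℝ), (0 : ℝ)) = 0 from rfl]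

/-- The local section `(x₃, x₄) ↦ (x₁, x₂, x₃, x₄)` of the projection. -/
def localSection (u v : ℝ) (y : ℝ × ℝ) : Fin 4 → ℝ := ![u, v, y.1, y.2]

lemma contDiff_localSection (u v : ℝ) : ContDiff ℝ ∞ (localSection u v) := by
  refine contDiff_pi.2 fun i => ?_
  fin_cases i
  · exact contDiff_const
  · exact contDiff_const
  · exact contDiff_fst
  · exact contDiff_snd

lemma eventually_localSection_mem (hD : IsOpen D) (hx : x ∈ D) :
    ∀ᶠ y in 𝓝 (proj x), localSection (x 0) (x 1) y ∈ D := by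
  have h0 : localSection (x 0) (x 1) (proj x) = x := by
    funext i
    fin_cases i <;> rfl
  exact (contDiff_localSection _ _).continuous.continuousAt.eventually_mem
    (by rw [h0]; exact hD.mem_nhds hx)

lemma isOpen_image_proj (hD : IsOpen D) : IsOpen (proj '' D) := by
  rw [isOpen_iff_mem_nhds]
  rintro _ ⟨x, hx, rfl⟩
  filter_upwards [eventually_localSection_mem hD hx] with y hy
  exact ⟨_, hy, rfl⟩

/-- A smooth function with vanishing derivatives along `∂₁` and `∂₂` is constant on the slices. -/
lemma eq_of_proj_eq (hD : IsOpen D)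
    (hDslice : ∀ s t : ℝ, IsPreconnected {x | x ∈ D ∧ x 2 = s ∧ x 3 = t})
    {F : (Fin 4 → ℝ) → ℝ} (hF : ContDiffOn ℝ ∞ F D) (h0 : ∀ x ∈ D, pd 0 F x = 0)
    (h1 : ∀ x ∈ D, pd 1 F x = 0) {x y : Fin 4 → ℝ} (hx : x ∈ D) (hy : y ∈ D)
    (hxy : proj x = proj y) : F x = F y := by
  let i : ℝ × ℝ → Fin 4 → ℝ := fun w => ![w.1, w.2, x 2, x 3]
  have hix : i (x 0, x 1) = x := by
    funext k
    fin_cases k <;> rfl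
  have hiy : i (y 0, y 1) = y := by
    have h2 : x 2 = y 2 := congrArg Prod.fst hxy
    have h3 : x 3 = y 3 := congrArg Prod.snd hxy
    funext k
    fin_cases k
    · rfl
    · rfl
    · exact h2
    · exact h3
  let L : ℝ × ℝ →L[ℝ] Fin 4 → ℝ :=
    (ContinuousLinearMap.fst ℝ ℝ ℝ).smulRight (Pi.single 0 1)
      + (ContinuousLinearMap.snd ℝ ℝ ℝ).smulRight (Pi.single 1 1)
  have hi' : i = fun w => L w + ![0, 0, x 2, x 3] := by
    funext w k
    fin_cases k <;> simp [i, L]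
  have hi : ∀ w, HasFDerivAt i L w := fun w => by
    rw [hi']
    exact L.hasFDerivAt.add_const _
  have hic : Continuous i := by
    rw [hi']
    exact L.continuous.add continuous_const
  have hFi : ∀ w ∈ i ⁻¹' D, HasFDerivAt (F ∘ i) ((fderiv ℝ F (i w)).comp L) w := fun w hw =>
    (differentiableAt_of_contDiffOn hD hF hw).hasFDerivAt.comp w (hi w)
  have himage : i ⁻¹' D =
      (fun z : Fin 4 → ℝ => (z 0, z 1)) '' {z | z ∈ D ∧ z 2 = x 2 ∧ z 3 = x 3} := by
    ext w
    constructor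
    · intro hw
      exact ⟨i w, ⟨hw, rfl, rfl⟩, rfl⟩
    · rintro ⟨z, ⟨hz, hz2, hz3⟩, rfl⟩
      have : i (z 0, z 1) = z := by
        funext k
        fin_cases k
        · rfl
        · rfl
        · exact hz2.symm
        · exact hz3.symm
      rw [Set.mem_preimage, this]
      exact hz
  have hpre : IsPreconnected (i ⁻¹' D) := by
    rw [himage]
    exact (hDslice _ _).image _ (by fun_prop)
  have := (hD.preimage hic).is_const_of_fderiv_eq_zero (𝕜 := ℝ) (f := F ∘ i) hpre
    (fun w hw => (hFi w hw).differentiableAt.differentiableWithinAt)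
    (fun w hw => by
      rw [(hFi w hw).fderiv]
      refine ContinuousLinearMap.ext fun v => ?_
      have e0 : fderiv ℝ F (i w) (Pi.single 0 1) = 0 := h0 _ hw
      have e1 : fderiv ℝ F (i w) (Pi.single 1 1) = 0 := h1 _ hw
      simp [L, e0, e1])
    (x := (x 0, x 1)) (y := (y 0, y 1)) (by rw [Set.mem_preimage, hix]; exact hx)
    (by rw [Set.mem_preimage, hiy]; exact hy)
  simpa [hix, hiy] using this

/-- A smooth function on `D` that does not depend infinitesimally on `(x₁, x₂)` is the pullback of
a smooth function on the projection of `D`: here the slices have to be connected. -/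
lemma exists_eq_comp_proj (hD : IsOpen D)
    (hDslice : ∀ s t : ℝ, IsPreconnected {x | x ∈ D ∧ x 2 = s ∧ x 3 = t})
    {F : (Fin 4 → ℝ) → ℝ} (hF : ContDiffOn ℝ ∞ F D) (h0 : ∀ x ∈ D, pd 0 F x = 0)
    (h1 : ∀ x ∈ D, pd 1 F x = 0) :
    ∃ f : ℝ × ℝ → ℝ, ContDiffOn ℝ ∞ f (proj '' D) ∧ ∀ x ∈ D, F x = f (proj x) := by
  classical
  let f : ℝ × ℝ → ℝ := fun y => if h : ∃ x ∈ D, proj x = y then F h.choose else 0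
  have hf : ∀ x ∈ D, F x = f (proj x) := by
    intro x hx
    have h : ∃ z ∈ D, proj z = proj x := ⟨x, hx, rfl⟩
    simp only [f, dif_pos h]
    exact eq_of_proj_eq hD hDslice hF h0 h1 hx h.choose_spec.1 h.choose_spec.2.symm
  refine ⟨f, ?_, hf⟩
  rintro _ ⟨x, hx, rfl⟩
  refine ContDiffAt.contDiffWithinAt ?_
  have hx0 : localSection (x 0) (x 1) (proj x) = x := by
    funext i
    fin_cases i <;> rfl
  have hloc : f =ᶠ[𝓝 (proj x)] F ∘ localSection (x 0) (x 1) := by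
    filter_upwards [eventually_localSection_mem hD hx] with y hy
    exact (hf _ hy).symm
  refine ContDiffAt.congr_of_eventuallyEq ?_ hloc
  refine ContDiffAt.comp _ ?_ (contDiff_localSection _ _).contDiffAt
  rw [hx0]
  exact hF.contDiffAt (hD.mem_nhds hx)

lemma eq_const_of_pd_eq_zero (hD : IsOpen D) (hDc : IsPreconnected D) {F : (Fin 4 → ℝ) → ℝ}
    (hF : ContDiffOn ℝ ∞ F D) (h : ∀ x ∈ D, ∀ i, pd i F x = 0) {x y : Fin 4 → ℝ} (hx : x ∈ D)
    (hy : y ∈ D) : F x = F y := by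
  refine hD.is_const_of_fderiv_eq_zero (𝕜 := ℝ) hDc (hF.differentiableOn (by simp))
    (fun z hz => ?_) hx hy
  refine ContinuousLinearMap.coe_injective (LinearMap.pi_ext' fun i => LinearMap.ext_ring ?_)
  exact h z hz i

/-! ### Walker metrics quadratic in `(x₁, x₂)` -/

/-- The quadratic polynomial in `(x₁, x₂)` with coefficients depending on `(x₃, x₄)`. -/
def quad (k l m p q w : ℝ × ℝ → ℝ) (x : Fin 4 → ℝ) : ℝ :=
  x 0 ^ 2 * k (proj x) + x 0 * x 1 * l (proj x) + x 1 ^ 2 * m (proj x) + x 0 * p (proj x)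
    + x 1 * q (proj x) + w (proj x)

/-- The first derivatives of a quadratic polynomial in `(x₁, x₂)` are again of this form. -/
lemma pd_quad (hD : IsOpen D) {k l m p q w : ℝ × ℝ → ℝ} (hk : ContDiffOn ℝ ∞ k (proj '' D))
    (hl : ContDiffOn ℝ ∞ l (proj '' D)) (hm : ContDiffOn ℝ ∞ m (proj '' D))
    (hp : ContDiffOn ℝ ∞ p (proj '' D)) (hq : ContDiffOn ℝ ∞ q (proj '' D))
    (hw : ContDiffOn ℝ ∞ w (proj '' D)) {f : (Fin 4 → ℝ) → ℝ} (hf : Set.EqOn f (quad k l m p q w) D)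
    (hx : x ∈ D) :
    pd 0 f x = quad 0 0 0 (fun y => 2 * k y) l p x ∧
    pd 1 f x = quad 0 0 0 l (fun y => 2 * m y) q x ∧
    pd 2 f x = quad (d3 k) (d3 l) (d3 m) (d3 p) (d3 q) (d3 w) x ∧
    pd 3 f x = quad (d4 k) (d4 l) (d4 m) (d4 p) (d4 q) (d4 w) x := by
  have hd : ∀ {u : ℝ × ℝ → ℝ}, ContDiffOn ℝ ∞ u (proj '' D) → DifferentiableAt ℝ u (proj x) :=
    fun hu => (hu.contDiffAt ((isOpen_image_proj hD).mem_nhds ⟨x, hx, rfl⟩)).differentiableAt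
      (by simp)
  have hdp : ∀ {u : ℝ × ℝ → ℝ}, ContDiffOn ℝ ∞ u (proj '' D) →
      DifferentiableAt ℝ (fun y => u (proj y)) x :=
    fun hu => (hd hu).comp x (hasFDerivAt_proj x).differentiableAt
  have hc : ∀ i, DifferentiableAt ℝ (fun y : Fin 4 → ℝ => y i) x := fun i => by fun_prop
  have hfx : f =ᶠ[𝓝 x] quad k l m p q w := hf.eventuallyEq_of_mem (hD.mem_nhds hx)
  have hpd : ∀ i, pd i (quad k l m p q w) x =
      (2 * x 0 * pd i (fun y => y 0) x) * k (proj x) + x 0 ^ 2 * pd i (fun y => k (proj y)) x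
      + (pd i (fun y => y 0) x * x 1 + x 0 * pd i (fun y => y 1) x) * l (proj x)
      + x 0 * x 1 * pd i (fun y => l (proj y)) x
      + (2 * x 1 * pd i (fun y => y 1) x) * m (proj x) + x 1 ^ 2 * pd i (fun y => m (proj y)) x
      + pd i (fun y => y 0) x * p (proj x) + x 0 * pd i (fun y => p (proj y)) x
      + pd i (fun y => y 1) x * q (proj x) + x 1 * pd i (fun y => q (proj y)) x
      + pd i (fun y => w (proj y)) x := by
    intro i
    have e : quad k l m p q w = fun x => x 0 * x 0 * k (proj x) + x 0 * x 1 * l (proj x)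
        + x 1 * x 1 * m (proj x) + x 0 * p (proj x) + x 1 * q (proj x) + w (proj x) := by
      funext y
      rw [quad]
      ring
    have d1 := ((hc 0).fun_mul (hc 0)).fun_mul (hdp hk)
    have d2 := ((hc 0).fun_mul (hc 1)).fun_mul (hdp hl)
    have d3 := ((hc 1).fun_mul (hc 1)).fun_mul (hdp hm)
    have d4 := (hc 0).fun_mul (hdp hp)
    have d5 := (hc 1).fun_mul (hdp hq)
    rw [e, pd_add ((((d1.fun_add d2).fun_add d3).fun_add d4).fun_add d5) (hdp hw),
      pd_add (((d1.fun_add d2).fun_add d3).fun_add d4) d5, pd_add ((d1.fun_add d2).fun_add d3) d4,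
      pd_add (d1.fun_add d2) d3, pd_add d1 d2, pd_mul ((hc 0).fun_mul (hc 0)) (hdp hk),
      pd_mul ((hc 0).fun_mul (hc 1)) (hdp hl), pd_mul ((hc 1).fun_mul (hc 1)) (hdp hm),
      pd_mul (hc 0) (hdp hp), pd_mul (hc 1) (hdp hq), pd_mul (hc 0) (hc 0), pd_mul (hc 0) (hc 1),
      pd_mul (hc 1) (hc 1)]
    ring
  simp only [pd_congr hfx, hpd, pd_comp_proj (hd hk), pd_comp_proj (hd hl), pd_comp_proj (hd hm),
    pd_comp_proj (hd hp), pd_comp_proj (hd hq), pd_comp_proj (hd hw), pd_coord]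
  refine ⟨?_, ?_, ?_, ?_⟩ <;>
  · simp [quad]
    try ring

lemma contDiffOn_d3 (hD : IsOpen D) {f : ℝ × ℝ → ℝ} (hf : ContDiffOn ℝ ∞ f (proj '' D)) :
    ContDiffOn ℝ ∞ (d3 f) (proj '' D) :=
  (hf.fderiv_of_isOpen (isOpen_image_proj hD) (m := ∞) (by simp)).clm_apply contDiffOn_const

lemma contDiffOn_d4 (hD : IsOpen D) {f : ℝ × ℝ → ℝ} (hf : ContDiffOn ℝ ∞ f (proj '' D)) :
    ContDiffOn ℝ ∞ (d4 f) (proj '' D) :=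
  (hf.fderiv_of_isOpen (isOpen_image_proj hD) (m := ∞) (by simp)).clm_apply contDiffOn_const

lemma d3_const (r : ℝ) : d3 (fun _ => r) = 0 := by
  funext y
  simp [d3]

lemma d4_const (r : ℝ) : d4 (fun _ => r) = 0 := by
  funext y
  simp [d4]

/-- The derivatives of a quadratic polynomial in `(x₁, x₂)` that enter the Ricci tensor. -/
lemma derivatives_of_eqOn_quad (hD : IsOpen D) {k l m p q w : ℝ × ℝ → ℝ}
    (hk : ContDiffOn ℝ ∞ k (proj '' D)) (hl : ContDiffOn ℝ ∞ l (proj '' D))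
    (hm : ContDiffOn ℝ ∞ m (proj '' D)) (hp : ContDiffOn ℝ ∞ p (proj '' D))
    (hq : ContDiffOn ℝ ∞ q (proj '' D)) (hw : ContDiffOn ℝ ∞ w (proj '' D))
    {f : (Fin 4 → ℝ) → ℝ} (hf : Set.EqOn f (quad k l m p q w) D) (hx : x ∈ D) :
    pd 0 f x = 2 * x 0 * k (proj x) + x 1 * l (proj x) + p (proj x) ∧
    pd 1 f x = x 0 * l (proj x) + 2 * x 1 * m (proj x) + q (proj x) ∧
    pd 0 (pd 0 f) x = 2 * k (proj x) ∧ pd 0 (pd 1 f) x = l (proj x) ∧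
    pd 1 (pd 1 f) x = 2 * m (proj x) ∧
    pd 0 (pd 2 f) x = 2 * x 0 * d3 k (proj x) + x 1 * d3 l (proj x) + d3 p (proj x) ∧
    pd 0 (pd 3 f) x = 2 * x 0 * d4 k (proj x) + x 1 * d4 l (proj x) + d4 p (proj x) ∧
    pd 1 (pd 2 f) x = x 0 * d3 l (proj x) + 2 * x 1 * d3 m (proj x) + d3 q (proj x) ∧
    pd 1 (pd 3 f) x = x 0 * d4 l (proj x) + 2 * x 1 * d4 m (proj x) + d4 q (proj x) := by
  have h1 := fun y (hy : y ∈ D) => pd_quad hD hk hl hm hp hq hw hf hy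
  have c0 : ContDiffOn ℝ ∞ (0 : ℝ × ℝ → ℝ) (proj '' D) := contDiffOn_const
  have hE0 := pd_quad hD c0 c0 c0 (contDiffOn_const.mul hk) hl hp (fun y hy => (h1 y hy).1) hx
  have hE1 := pd_quad hD c0 c0 c0 hl (contDiffOn_const.mul hm) hq (fun y hy => (h1 y hy).2.1) hx
  have hE2 := pd_quad hD (contDiffOn_d3 hD hk) (contDiffOn_d3 hD hl) (contDiffOn_d3 hD hm)
    (contDiffOn_d3 hD hp) (contDiffOn_d3 hD hq) (contDiffOn_d3 hD hw)
    (fun y hy => (h1 y hy).2.2.1) hx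
  have hE3 := pd_quad hD (contDiffOn_d4 hD hk) (contDiffOn_d4 hD hl) (contDiffOn_d4 hD hm)
    (contDiffOn_d4 hD hp) (contDiffOn_d4 hD hq) (contDiffOn_d4 hD hw)
    (fun y hy => (h1 y hy).2.2.2) hx
  obtain ⟨f0, f1, -⟩ := h1 x hx
  refine ⟨f0.trans ?_, f1.trans ?_, hE0.1.trans ?_, hE1.1.trans ?_, hE1.2.1.trans ?_,
    hE2.1.trans ?_, hE3.1.trans ?_, hE2.2.1.trans ?_, hE3.2.1.trans ?_⟩ <;>
  · simp [quad]
    try ring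

/-- The Walker metrics for which `a`, `b`, `c` are quadratic in `(x₁, x₂)` with leading terms
`x₁² s / 6`, `x₂² s / 6`, `x₁ x₂ s / 6`; at this stage `s` may depend on `(x₃, x₄)`. -/
structure IsQuadratic (D : Set (Fin 4 → ℝ)) (a b c : (Fin 4 → ℝ) → ℝ)
    (s P Q S T U V ξ η γ : ℝ × ℝ → ℝ) : Prop where
  smooth_s : ContDiffOn ℝ ∞ s (proj '' D)
  smooth : SmoothCoeffs D P Q S T U V
  smooth_ξ : ContDiffOn ℝ ∞ ξ (proj '' D)
  smooth_η : ContDiffOn ℝ ∞ η (proj '' D)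
  smooth_γ : ContDiffOn ℝ ∞ γ (proj '' D)
  a_eq : Set.EqOn a (quad (fun y => s y / 6) 0 0 P Q ξ) D
  b_eq : Set.EqOn b (quad 0 0 (fun y => s y / 6) S T η) D
  c_eq : Set.EqOn c (quad 0 (fun y => s y / 6) 0 U V γ) D

/-- The first-order system for the coefficients that expresses, when `s` is constant, that a
quadratic Walker metric is Einstein. -/
structure CoeffEqs (s : ℝ) (P Q S T U V ξ η γ : ℝ × ℝ → ℝ) (y : ℝ × ℝ) : Prop where
  eq_a : s / 6 * ξ y = Q y * (T y - U y) + V y * (P y - V y) - 2 * (d4 Q y - d3 V y)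
  eq_b : s / 6 * η y = S y * (P y - V y) + U y * (T y - U y) - 2 * (d3 S y - d4 U y)
  eq_c : s / 6 * γ y = -(Q y * S y) + U y * V y + d3 T y - d3 U y + d4 P y - d4 V y

lemma d3_div (hD : IsOpen D) {s : ℝ × ℝ → ℝ} (hs : ContDiffOn ℝ ∞ s (proj '' D)) (hx : x ∈ D) :
    d3 (fun y => s y / 6) (proj x) = d3 s (proj x) / 6 ∧
    d4 (fun y => s y / 6) (proj x) = d4 s (proj x) / 6 := by
  have h : DifferentiableAt ℝ s (proj x) :=
    (hs.contDiffAt ((isOpen_image_proj hD).mem_nhds ⟨x, hx, rfl⟩)).differentiableAt (by simp)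
  have : (fun y => s y / 6) = fun y => (1 / 6 : ℝ) * s y := by
    funext y
    ring
  rw [this, d3, d4, fderiv_const_mul h]
  simp [d3, d4]
  constructor <;> ring

variable {s P Q S T U V ξ η γ : ℝ × ℝ → ℝ}

lemma IsQuadratic.selfDualEqs (h : SmoothWalker D a b c)
    (hQ : IsQuadratic D a b c s P Q S T U V ξ η γ) (hx : x ∈ D) : SelfDualEqs a b c x := by
  obtain ⟨hs, ⟨hP, hQ', hS, hT, hU, hV⟩, hξ, hη, hγ, ea, eb, ec⟩ := hQ
  have c0 : ContDiffOn ℝ ∞ (0 : ℝ × ℝ → ℝ) (proj '' D) := contDiffOn_const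
  have hs6 : ContDiffOn ℝ ∞ (fun y => s y / 6) (proj '' D) := hs.div_const 6
  obtain ⟨-, -, a00, a01, a11, -⟩ := derivatives_of_eqOn_quad h.isOpen hs6 c0 c0 hP hQ' hξ ea hx
  obtain ⟨-, -, b00, b01, b11, -⟩ := derivatives_of_eqOn_quad h.isOpen c0 c0 hs6 hS hT hη eb hx
  obtain ⟨-, -, c00, c01, c11, -⟩ := derivatives_of_eqOn_quad h.isOpen c0 hs6 c0 hU hV hγ ec hx
  constructor
  · simpa using a11
  · simpa using b00
  · rw [a01, c11]
    simp
  · rw [b01, c00]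
    simp
  · rw [a00, b11, c01]
    ring

/-- The Ricci tensor of a quadratic Walker metric, written as `s / 4` times the metric plus a
trace-free part. -/
lemma IsQuadratic.ricci_eq (h : SmoothWalker D a b c)
    (hQ : IsQuadratic D a b c s P Q S T U V ξ η γ) (hx : x ∈ D) :
    let y := proj x
    ricci (walker a b c) 0 2 x = s y / 4 ∧ ricci (walker a b c) 0 3 x = 0 ∧
    ricci (walker a b c) 1 2 x = 0 ∧ ricci (walker a b c) 1 3 x = s y / 4 ∧
    ricci (walker a b c) 2 2 x = s y / 4 * a x + x 0 * d3 s y / 6 + (Q y * (T y - U y)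
      + V y * (P y - V y) - 2 * (d4 Q y - d3 V y) - s y / 6 * ξ y) / 2 ∧
    ricci (walker a b c) 2 3 x = s y / 4 * c x + (x 1 * d3 s y + x 0 * d4 s y) / 12
      + (-(Q y * S y) + U y * V y + d3 T y - d3 U y + d4 P y - d4 V y - s y / 6 * γ y) / 2 ∧
    ricci (walker a b c) 3 3 x = s y / 4 * b x + x 1 * d4 s y / 6 + (S y * (P y - V y)
      + U y * (T y - U y) - 2 * (d3 S y - d4 U y) - s y / 6 * η y) / 2 := by
  intro y
  obtain ⟨hs, ⟨hP, hQ', hS, hT, hU, hV⟩, hξ, hη, hγ, ea, eb, ec⟩ := hQ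
  have c0 : ContDiffOn ℝ ∞ (0 : ℝ × ℝ → ℝ) (proj '' D) := contDiffOn_const
  have hs6 : ContDiffOn ℝ ∞ (fun y => s y / 6) (proj '' D) := hs.div_const 6
  obtain ⟨a0, a1, a00, a01, a11, a02, a03, a12, a13⟩ :=
    derivatives_of_eqOn_quad h.isOpen hs6 c0 c0 hP hQ' hξ ea hx
  obtain ⟨b0, b1, b00, b01, b11, b02, b03, b12, b13⟩ :=
    derivatives_of_eqOn_quad h.isOpen c0 c0 hs6 hS hT hη eb hx
  obtain ⟨c0', c1, c00, c01, c11, c02, c03, c12, c13⟩ :=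
    derivatives_of_eqOn_quad h.isOpen c0 hs6 c0 hU hV hγ ec hx
  obtain ⟨-, -, r02, r03, -, r12, r13, r22, r23, r33⟩ := ricci_walker_components h hx
  obtain ⟨s3, s4⟩ := d3_div h.isOpen hs hx
  have z3 : d3 (0 : ℝ × ℝ → ℝ) = 0 := d3_const 0
  have z4 : d4 (0 : ℝ × ℝ → ℝ) = 0 := d4_const 0
  rw [r02, r03, r12, r13, r22, r23, r33, ea hx, eb hx, ec hx]
  simp only [a0, a1, a00, a01, a11, a03, a13, b0, b1, b00, b01, b11, b02, b12, c0',
    c1, c00, c01, c11, c02, c03, c12, c13, quad, z3, z4, s3, s4, Pi.zero_apply]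
  refine ⟨?_, ?_, ?_, ?_, ?_, ?_, ?_⟩ <;> ring

/-- The trace-free part of the Ricci tensor vanishes by `CoeffEqs`. -/
lemma IsQuadratic.einsteinSelfDualAt (h : SmoothWalker D a b c) {τ : ℝ}
    (hQ : IsQuadratic D a b c (fun _ => τ) P Q S T U V ξ η γ) (hx : x ∈ D)
    (hC : CoeffEqs τ P Q S T U V ξ η γ (proj x)) : EinsteinSelfDualAt a b c τ x := by
  refine ⟨fun i j => ?_, hQ.selfDualEqs h hx⟩
  have hs := ricci_symm h hx
  obtain ⟨r00, r01, -, -, r11, -⟩ := ricci_walker_components h hx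
  obtain ⟨r02, r03, r12, r13, r22, r23, r33⟩ := hQ.ricci_eq h hx
  obtain ⟨e1, e2, e3⟩ := hC
  fin_cases i <;> fin_cases j <;>
    simp [walker, r00, r01, r11, hs 0 1, hs 0 2, hs 0 3, hs 1 2, hs 1 3, hs 2 3, r02, r03, r12, r13,
      r22, r23, r33, d3_const, d4_const, e1, e2, e3]

/-! ### Integration of the Einstein and self-duality equations -/

lemma contDiffOn_quad {k l m p q w : ℝ × ℝ → ℝ} (hk : ContDiffOn ℝ ∞ k (proj '' D))
    (hl : ContDiffOn ℝ ∞ l (proj '' D)) (hm : ContDiffOn ℝ ∞ m (proj '' D))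
    (hp : ContDiffOn ℝ ∞ p (proj '' D)) (hq : ContDiffOn ℝ ∞ q (proj '' D))
    (hw : ContDiffOn ℝ ∞ w (proj '' D)) : ContDiffOn ℝ ∞ (quad k l m p q w) D := by
  have hc : ∀ {u : ℝ × ℝ → ℝ}, ContDiffOn ℝ ∞ u (proj '' D) →
      ContDiffOn ℝ ∞ (fun x => u (proj x)) D :=
    fun hu => hu.comp contDiff_proj.contDiffOn (Set.mapsTo_image _ _)
  have hx : ∀ i, ContDiffOn ℝ ∞ (fun y : Fin 4 → ℝ => y i) D :=
    fun i => (contDiff_apply ℝ ℝ i).contDiffOn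
  exact ((((((hx 0).pow 2).mul (hc hk)).add (((hx 0).mul (hx 1)).mul (hc hl))).add
    (((hx 1).pow 2).mul (hc hm))).add ((hx 0).mul (hc hp))).add ((hx 1).mul (hc hq)) |>.add (hc hw)

/-- Taylor's formula along the slices: a function whose second derivatives in `(x₁, x₂)` depend
only on `(x₃, x₄)` is a quadratic polynomial in `(x₁, x₂)`. -/
lemma exists_eqOn_quad (hD : IsOpen D)
    (hDslice : ∀ s t : ℝ, IsPreconnected {x | x ∈ D ∧ x 2 = s ∧ x 3 = t})
    {f : (Fin 4 → ℝ) → ℝ} (hf : ContDiffOn ℝ ∞ f D) {k l m : ℝ × ℝ → ℝ}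
    (hk : ContDiffOn ℝ ∞ k (proj '' D)) (hl : ContDiffOn ℝ ∞ l (proj '' D))
    (hm : ContDiffOn ℝ ∞ m (proj '' D))
    (h00 : ∀ x ∈ D, pd 0 (pd 0 f) x = 2 * k (proj x))
    (h01 : ∀ x ∈ D, pd 0 (pd 1 f) x = l (proj x))
    (h11 : ∀ x ∈ D, pd 1 (pd 1 f) x = 2 * m (proj x)) :
    ∃ p q w : ℝ × ℝ → ℝ, ContDiffOn ℝ ∞ p (proj '' D) ∧ ContDiffOn ℝ ∞ q (proj '' D) ∧
      ContDiffOn ℝ ∞ w (proj '' D) ∧ Set.EqOn f (quad k l m p q w) D := by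
  have c0 : ContDiffOn ℝ ∞ (0 : ℝ × ℝ → ℝ) (proj '' D) := contDiffOn_const
  have h2k : ContDiffOn ℝ ∞ (fun y => 2 * k y) (proj '' D) := contDiffOn_const.mul hk
  have h2m : ContDiffOn ℝ ∞ (fun y => 2 * m y) (proj '' D) := contDiffOn_const.mul hm
  have hd : ∀ {u : (Fin 4 → ℝ) → ℝ}, ContDiffOn ℝ ∞ u D → ∀ x ∈ D, DifferentiableAt ℝ u x :=
    fun hu x hx => differentiableAt_of_contDiffOn hD hu hx
  have hf0 := contDiffOn_pd hD hf 0
  have hf1 := contDiffOn_pd hD hf 1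
  have q0 := contDiffOn_quad c0 c0 c0 h2k hl c0
  have q1 := contDiffOn_quad c0 c0 c0 hl h2m c0
  obtain ⟨p, hp, hpe⟩ := exists_eq_comp_proj hD hDslice (hf0.sub q0)
    (fun x hx => by
      refine (pd_sub (hd hf0 x hx) (hd q0 x hx) 0).trans ?_
      rw [h00 x hx, (pd_quad hD c0 c0 c0 h2k hl c0 (fun _ _ => rfl) hx).1]
      simp [quad])
    (fun x hx => by
      refine (pd_sub (hd hf0 x hx) (hd q0 x hx) 1).trans ?_
      rw [pd_comm hD hf hx, h01 x hx, (pd_quad hD c0 c0 c0 h2k hl c0 (fun _ _ => rfl) hx).2.1]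
      simp [quad])
  obtain ⟨q, hq, hqe⟩ := exists_eq_comp_proj hD hDslice (hf1.sub q1)
    (fun x hx => by
      refine (pd_sub (hd hf1 x hx) (hd q1 x hx) 0).trans ?_
      rw [h01 x hx, (pd_quad hD c0 c0 c0 hl h2m c0 (fun _ _ => rfl) hx).1]
      simp [quad])
    (fun x hx => by
      refine (pd_sub (hd hf1 x hx) (hd q1 x hx) 1).trans ?_
      rw [h11 x hx, (pd_quad hD c0 c0 c0 hl h2m c0 (fun _ _ => rfl) hx).2.1]
      simp [quad])
  have qw := contDiffOn_quad hk hl hm hp hq c0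
  obtain ⟨w, hw, hwe⟩ := exists_eq_comp_proj hD hDslice (hf.sub qw)
    (fun x hx => by
      refine (pd_sub (hd hf x hx) (hd qw x hx) 0).trans ?_
      rw [(pd_quad hD hk hl hm hp hq c0 (fun _ _ => rfl) hx).1]
      have := hpe x hx
      simp only [quad, Pi.zero_apply] at this ⊢
      linarith)
    (fun x hx => by
      refine (pd_sub (hd hf x hx) (hd qw x hx) 1).trans ?_
      rw [(pd_quad hD hk hl hm hp hq c0 (fun _ _ => rfl) hx).2.1]
      have := hqe x hx
      simp only [quad, Pi.zero_apply] at this ⊢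
      linarith)
  refine ⟨p, q, w, hp, hq, hw, fun x hx => ?_⟩
  have := hwe x hx
  simp only [quad, Pi.zero_apply] at this ⊢
  linarith

/-- The scalar curvature, which is six times the mixed derivative of `c`, depends only on
`(x₃, x₄)` because the pure second derivatives of `c` in `(x₁, x₂)` vanish. -/
lemma exists_isQuadratic (h : SmoothWalker D a b c)
    (hDslice : ∀ s t : ℝ, IsPreconnected {x | x ∈ D ∧ x 2 = s ∧ x 3 = t})
    (hE : ∀ x ∈ D, ∃ τ, EinsteinSelfDualAt a b c τ x) :
    ∃ s P Q S T U V ξ η γ : ℝ × ℝ → ℝ, IsQuadratic D a b c s P Q S T U V ξ η γ := by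
  have hD := h.isOpen
  have hc0 := contDiffOn_pd hD h.smooth_c 0
  have hc1 := contDiffOn_pd hD h.smooth_c 1
  have hc01 := contDiffOn_pd hD hc1 0
  have e00 : ∀ x ∈ D, pd 0 (pd 0 c) x = 0 := fun x hx => by
    obtain ⟨τ, hτ⟩ := hE x hx
    exact (hτ.second_derivatives h hx).2.2.2.2.2.2.1
  have e11 : ∀ x ∈ D, pd 1 (pd 1 c) x = 0 := fun x hx => by
    obtain ⟨τ, hτ⟩ := hE x hx
    exact (hτ.second_derivatives h hx).2.2.2.2.2.2.2.2
  have pd_zero : ∀ {u : (Fin 4 → ℝ) → ℝ}, (∀ x ∈ D, u x = 0) → ∀ x ∈ D, ∀ i, pd i u x = 0 := by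
    intro u hu x hx i
    have : u =ᶠ[𝓝 x] fun _ => 0 := by
      filter_upwards [hD.mem_nhds hx] with y hy using hu y hy
    rw [pd_congr this, pd_const]
  obtain ⟨k, hk, hke⟩ := exists_eq_comp_proj hD hDslice hc01
    (fun x hx => by
      have : pd 0 (pd 1 c) =ᶠ[𝓝 x] pd 1 (pd 0 c) := by
        filter_upwards [hD.mem_nhds hx] with y hy using pd_comm hD h.smooth_c hy 0 1
      rw [pd_congr this, pd_comm hD hc0 hx, pd_zero e00 x hx])
    (fun x hx => by rw [pd_comm hD hc1 hx, pd_zero e11 x hx])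
  have c0 : ContDiffOn ℝ ∞ (0 : ℝ × ℝ → ℝ) (proj '' D) := contDiffOn_const
  have hs6 : ContDiffOn ℝ ∞ (fun y => 6 * k y / 6) (proj '' D) :=
    (contDiffOn_const.mul hk).div_const 6
  have hE' : ∀ x ∈ D, ∃ τ, k (proj x) = τ / 6 ∧ EinsteinSelfDualAt a b c τ x := fun x hx => by
    obtain ⟨τ, hτ⟩ := hE x hx
    exact ⟨τ, (hke x hx).symm.trans (hτ.second_derivatives h hx).2.2.2.2.2.2.2.1, hτ⟩
  obtain ⟨P, Q, ξ, hP, hQ, hξ, ea⟩ := exists_eqOn_quad hD hDslice h.smooth_a hs6 c0 c0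
    (fun x hx => by
      obtain ⟨τ, hk, hτ⟩ := hE' x hx
      linarith [(hτ.second_derivatives h hx).1])
    (fun x hx => by
      obtain ⟨τ, -, hτ⟩ := hE' x hx
      exact (hτ.second_derivatives h hx).2.1)
    (fun x hx => by
      obtain ⟨τ, -, hτ⟩ := hE' x hx
      simpa using (hτ.second_derivatives h hx).2.2.1)
  obtain ⟨S, T, η, hS, hT, hη, eb⟩ := exists_eqOn_quad hD hDslice h.smooth_b c0 c0 hs6
    (fun x hx => by
      obtain ⟨τ, -, hτ⟩ := hE' x hx
      simpa using (hτ.second_derivatives h hx).2.2.2.1)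
    (fun x hx => by
      obtain ⟨τ, -, hτ⟩ := hE' x hx
      exact (hτ.second_derivatives h hx).2.2.2.2.1)
    (fun x hx => by
      obtain ⟨τ, hk, hτ⟩ := hE' x hx
      linarith [(hτ.second_derivatives h hx).2.2.2.2.2.1])
  obtain ⟨U, V, γ, hU, hV, hγ, ec⟩ := exists_eqOn_quad hD hDslice h.smooth_c c0 hs6 c0
    (fun x hx => by simpa using e00 x hx)
    (fun x hx => by rw [hke x hx]; ring)
    (fun x hx => by simpa using e11 x hx)
  exact ⟨fun y => 6 * k y, P, Q, S, T, U, V, ξ, η, γ, contDiffOn_const.mul hk,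
    ⟨hP, hQ, hS, hT, hU, hV⟩, hξ, hη, hγ, ea, eb, ec⟩

/-- An open set contains points displaced from a given point along a coordinate line. -/
lemma exists_shift_mem (hD : IsOpen D) (hx : x ∈ D) (i : Fin 4) :
    ∃ δ : ℝ, δ ≠ 0 ∧ Function.update x i (x i + δ) ∈ D := by
  have hc : Continuous fun δ : ℝ => Function.update x i (x i + δ) :=
    continuous_const.update i (continuous_const.add continuous_id)
  have h0 : ∀ᶠ δ in 𝓝[≠] (0 : ℝ), Function.update x i (x i + δ) ∈ D :=
    (hc.continuousAt.eventually_mem (by simpa using hD.mem_nhds hx)).filter_mono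
      nhdsWithin_le_nhds
  obtain ⟨δ, hδ, hδ0⟩ := (h0.and eventually_mem_nhdsWithin).exists
  exact ⟨δ, hδ0, hδ⟩

/-- In the Einstein equations of a quadratic Walker metric, `x₁` and `x₂` occur only in products
with the derivatives of `s`; moving along a slice shows that these derivatives vanish. -/
lemma IsQuadratic.d3_eq_zero_and_d4_eq_zero (h : SmoothWalker D a b c)
    (hQ : IsQuadratic D a b c s P Q S T U V ξ η γ)
    (hE : ∀ x ∈ D, ∃ τ, EinsteinSelfDualAt a b c τ x) (hx : x ∈ D) :
    d3 s (proj x) = 0 ∧ d4 s (proj x) = 0 := by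
  have hR : ∀ z ∈ D, ricci (walker a b c) 2 2 z = s (proj z) / 4 * a z ∧
      ricci (walker a b c) 3 3 z = s (proj z) / 4 * b z := fun z hz => by
    obtain ⟨τ, hτ⟩ := hE z hz
    have h02 : s (proj z) / 4 = τ / 4 * 1 := (hQ.ricci_eq h hz).1.symm.trans (hτ.ricci_eq 0 2)
    rw [h02, mul_one]
    exact ⟨hτ.ricci_eq 2 2, hτ.ricci_eq 3 3⟩
  constructor
  · obtain ⟨δ, hδ, hδD⟩ := exists_shift_mem h.isOpen hx 0
    have hp : proj (Function.update x 0 (x 0 + δ)) = proj x := by simp [proj]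
    have e1 := (hQ.ricci_eq h hx).2.2.2.2.1.symm.trans (hR x hx).1
    have e2 := (hQ.ricci_eq h hδD).2.2.2.2.1.symm.trans (hR _ hδD).1
    rw [hp, Function.update_self] at e2
    have : δ * d3 s (proj x) = 0 := by linear_combination 6 * e2 - 6 * e1
    exact (mul_eq_zero.1 this).resolve_left hδ
  · obtain ⟨δ, hδ, hδD⟩ := exists_shift_mem h.isOpen hx 1
    have hp : proj (Function.update x 1 (x 1 + δ)) = proj x := by simp [proj]
    have e1 := (hQ.ricci_eq h hx).2.2.2.2.2.2.symm.trans (hR x hx).2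
    have e2 := (hQ.ricci_eq h hδD).2.2.2.2.2.2.symm.trans (hR _ hδD).2
    rw [hp, Function.update_self] at e2
    have : δ * d4 s (proj x) = 0 := by linear_combination 6 * e2 - 6 * e1
    exact (mul_eq_zero.1 this).resolve_left hδ

/-- Since `D` is connected, `s` is constant. -/
lemma exists_isQuadratic_const (h : SmoothWalker D a b c) (hDconn : IsConnected D)
    (hDslice : ∀ s t : ℝ, IsPreconnected {x | x ∈ D ∧ x 2 = s ∧ x 3 = t})
    (hE : ∀ x ∈ D, ∃ τ, EinsteinSelfDualAt a b c τ x) :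
    ∃ (τ : ℝ) (P Q S T U V ξ η γ : ℝ × ℝ → ℝ),
      IsQuadratic D a b c (fun _ => τ) P Q S T U V ξ η γ ∧
      ∀ y ∈ proj '' D, CoeffEqs τ P Q S T U V ξ η γ y := by
  obtain ⟨s, P, Q, S, T, U, V, ξ, η, γ, hQ⟩ := exists_isQuadratic h hDslice hE
  obtain ⟨x₀, hx₀⟩ := hDconn.nonempty
  have hs : ∀ x ∈ D, s (proj x) = s (proj x₀) := fun x hx => by
    refine eq_const_of_pd_eq_zero (F := fun x => s (proj x)) h.isOpen hDconn.isPreconnected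
      (hQ.smooth_s.comp contDiff_proj.contDiffOn (Set.mapsTo_image _ _)) (fun z hz => ?_) hx hx₀
    obtain ⟨h3, h4⟩ := hQ.d3_eq_zero_and_d4_eq_zero h hE hz
    obtain ⟨p0, p1, p2, p3⟩ := pd_comp_proj (x := z) ((hQ.smooth_s.contDiffAt
      ((isOpen_image_proj h.isOpen).mem_nhds ⟨z, hz, rfl⟩)).differentiableAt (by simp))
    intro i
    fin_cases i
    · exact p0
    · exact p1
    · exact p2.trans h3
    · exact p3.trans h4
  have hQ' : IsQuadratic D a b c (fun _ => s (proj x₀)) P Q S T U V ξ η γ :=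
    ⟨contDiffOn_const, hQ.smooth, hQ.smooth_ξ, hQ.smooth_η, hQ.smooth_γ,
      fun x hx => by simpa only [quad, hs x hx] using hQ.a_eq hx,
      fun x hx => by simpa only [quad, hs x hx] using hQ.b_eq hx,
      fun x hx => by simpa only [quad, hs x hx] using hQ.c_eq hx⟩
  refine ⟨s (proj x₀), P, Q, S, T, U, V, ξ, η, γ, hQ', ?_⟩
  rintro _ ⟨x, hx, rfl⟩
  obtain ⟨τ, hτ⟩ := hE x hx
  obtain ⟨r02, -, -, -, r22, r23, r33⟩ := hQ'.ricci_eq h hx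
  have h02 : s (proj x₀) / 4 = τ / 4 * 1 := r02.symm.trans (hτ.ricci_eq 0 2)
  have e22 : _ = τ / 4 * a x := r22.symm.trans (hτ.ricci_eq 2 2)
  have e23 : _ = τ / 4 * c x := r23.symm.trans (hτ.ricci_eq 2 3)
  have e33 : _ = τ / 4 * b x := r33.symm.trans (hτ.ricci_eq 3 3)
  simp only [d3_const, d4_const, Pi.zero_apply] at e22 e23 e33
  constructor
  · linear_combination -2 * e22 + 2 * a x * h02
  · linear_combination -2 * e33 + 2 * b x * h02
  · linear_combination -2 * e23 + 2 * c x * h02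

/-! ### The two normal forms -/

/-- In the case of nonzero scalar curvature, the system `CoeffEqs` only determines the terms of `a`,
`b`, `c` that are constant along the slices. -/
lemma isQuadratic_of_formNonzero (hD : IsOpen D) {τ : ℝ}
    (hF : FormNonzero D a b c τ P Q S T U V) :
    ∃ ξ η γ, IsQuadratic D a b c (fun _ => τ) P Q S T U V ξ η γ ∧
      ∀ y, CoeffEqs τ P Q S T U V ξ η γ y := by
  obtain ⟨hτ, -, hS, hform⟩ := hF
  obtain ⟨hP, hQ, hS', hT, hU, hV⟩ := id hS
  refine ⟨fun y => 6 / τ * (Q y * (T y - U y) + V y * (P y - V y) - 2 * (d4 Q y - d3 V y)),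
    fun y => 6 / τ * (S y * (P y - V y) + U y * (T y - U y) - 2 * (d3 S y - d4 U y)),
    fun y => 6 / τ * (-(Q y * S y) + U y * V y + d3 T y - d3 U y + d4 P y - d4 V y),
    ⟨contDiffOn_const, hS, ?_, ?_, ?_, fun x hx => ?_, fun x hx => ?_, fun x hx => ?_⟩,
    fun y => ⟨?_, ?_, ?_⟩⟩
  · exact contDiffOn_const.mul (((hQ.mul (hT.sub hU)).add (hV.mul (hP.sub hV))).sub
      (contDiffOn_const.mul ((contDiffOn_d4 hD hQ).sub (contDiffOn_d3 hD hV))))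
  · exact contDiffOn_const.mul (((hS'.mul (hP.sub hV)).add (hU.mul (hT.sub hU))).sub
      (contDiffOn_const.mul ((contDiffOn_d3 hD hS').sub (contDiffOn_d4 hD hU))))
  · exact contDiffOn_const.mul ((((((hQ.mul hS').neg.add (hU.mul hV)).add (contDiffOn_d3 hD hT)).sub
      (contDiffOn_d3 hD hU)).add (contDiffOn_d4 hD hP)).sub (contDiffOn_d4 hD hV))
  · rw [(hform x hx _ rfl).1, quad]
    simp
  · rw [(hform x hx _ rfl).2.1, quad]
    simp
  · rw [(hform x hx _ rfl).2.2, quad]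
    simp
  · field_simp
  · field_simp
  · field_simp

lemma isQuadratic_of_formZero (hF : FormZero D a b c P Q S T U V ξ η γ) :
    IsQuadratic D a b c (fun _ => 0) P Q S T U V ξ η γ ∧
      ∀ y ∈ proj '' D, CoeffEqs 0 P Q S T U V ξ η γ y := by
  obtain ⟨-, hS, hξ, hη, hγ, hform, heqs⟩ := hF
  refine ⟨⟨contDiffOn_const, hS, hξ, hη, hγ, fun x hx => ?_, fun x hx => ?_, fun x hx => ?_⟩,
    fun y hy => ?_⟩
  · rw [(hform x hx _ rfl).1]
    simp [quad]
  · rw [(hform x hx _ rfl).2.1]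
    simp [quad]
  · rw [(hform x hx _ rfl).2.2]
    simp [quad]
  · obtain ⟨h1, h2, h3⟩ := heqs y hy
    constructor <;> linarith

lemma formNonzero_or_formZero (h : SmoothWalker D a b c) {τ : ℝ}
    (hQ : IsQuadratic D a b c (fun _ => τ) P Q S T U V ξ η γ)
    (hC : ∀ y ∈ proj '' D, CoeffEqs τ P Q S T U V ξ η γ y) :
    FormNonzero D a b c τ P Q S T U V ∨ FormZero D a b c P Q S T U V ξ η γ := by
  have hscal : ∀ x ∈ D, scal (walker a b c) x = τ := fun x hx =>
    (hQ.einsteinSelfDualAt h hx (hC _ ⟨x, hx, rfl⟩)).scal_eq h hx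
  rcases eq_or_ne τ 0 with rfl | hτ
  · refine Or.inr ⟨hscal, hQ.smooth, hQ.smooth_ξ, hQ.smooth_η, hQ.smooth_γ, ?_, fun y hy => ?_⟩
    · rintro x hx _ rfl
      rw [hQ.a_eq hx, hQ.b_eq hx, hQ.c_eq hx]
      simp [quad]
    · obtain ⟨h1, h2, h3⟩ := hC y hy
      refine ⟨?_, ?_, ?_⟩ <;> linarith
  · refine Or.inl ⟨hτ, hscal, hQ.smooth, ?_⟩
    rintro x hx _ rfl
    obtain ⟨h1, h2, h3⟩ := hC _ ⟨x, hx, rfl⟩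
    have h6 : ∀ r, r = 6 / τ * (τ / 6 * r) := fun r => by field_simp
    rw [← h1, ← h2, ← h3, ← h6, ← h6, ← h6, hQ.a_eq hx, hQ.b_eq hx, hQ.c_eq hx]
    simp [quad]

lemma osserman_and_selfDual_iff (h : SmoothWalker D a b c) (hDconn : IsConnected D)
    (hDslice : ∀ s t : ℝ, IsPreconnected {x | x ∈ D ∧ x 2 = s ∧ x 3 = t}) :
    (IsPointwiseOsserman (walker a b c) D ∧ IsSelfDual (walker a b c) D) ↔
      ((∃ (τ : ℝ) (P Q S T U V : ℝ × ℝ → ℝ), FormNonzero D a b c τ P Q S T U V) ∨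
       (∃ P Q S T U V ξ η γ : ℝ × ℝ → ℝ, FormZero D a b c P Q S T U V ξ η γ)) := by
  constructor
  · rintro ⟨hO, hS⟩
    obtain ⟨τ, P, Q, S, T, U, V, ξ, η, γ, hQ, hC⟩ := exists_isQuadratic_const h hDconn hDslice
      fun x hx => exists_einsteinSelfDualAt h hO hS hx
    rcases formNonzero_or_formZero h hQ hC with hF | hF
    · exact Or.inl ⟨τ, P, Q, S, T, U, V, hF⟩
    · exact Or.inr ⟨P, Q, S, T, U, V, ξ, η, γ, hF⟩
  · intro hF
    have hE : ∀ x ∈ D, ∃ τ, EinsteinSelfDualAt a b c τ x := by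
      rcases hF with ⟨τ, P, Q, S, T, U, V, hF⟩ | ⟨P, Q, S, T, U, V, ξ, η, γ, hF⟩
      · obtain ⟨ξ, η, γ, hQ, hC⟩ := isQuadratic_of_formNonzero h.isOpen hF
        exact fun x hx => ⟨τ, hQ.einsteinSelfDualAt h hx (hC _)⟩
      · obtain ⟨hQ, hC⟩ := isQuadratic_of_formZero hF
        exact fun x hx => ⟨0, hQ.einsteinSelfDualAt h hx (hC _ ⟨x, hx, rfl⟩)⟩
    exact ⟨isPointwiseOsserman_of_einsteinSelfDual h hE, isSelfDual_of_einsteinSelfDual h hE⟩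

/-! ### The Jacobi operators in the two cases -/

lemma continuousOn_diagExpr (h : SmoothWalker D a b c) (τ : ℝ) :
    ContinuousOn (diagExpr a b c τ) D := by
  have key : ∀ {f : (Fin 4 → ℝ) → ℝ}, ContDiffOn ℝ ∞ f D → ContinuousOn f D ∧
      (∀ i, ContinuousOn (pd i f) D) ∧ ∀ i j, ContinuousOn (pd i (pd j f)) D := fun hf =>
    ⟨hf.continuousOn, fun i => (contDiffOn_pd h.isOpen hf i).continuousOn, fun i j =>
      (contDiffOn_pd h.isOpen (contDiffOn_pd h.isOpen hf j) i).continuousOn⟩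
  obtain ⟨a0, a1, a2⟩ := key h.smooth_a
  obtain ⟨b0, b1, b2⟩ := key h.smooth_b
  obtain ⟨c0, c1, c2⟩ := key h.smooth_c
  have h11 : ContinuousOn (w11Expr a b c) D := by
    unfold w11Expr
    fun_prop
  have h12 : ContinuousOn (w12Expr a b c) D := by
    unfold w12Expr
    fun_prop
  have : ContinuousOn (fun x => τ ^ 2 + 12 * τ * w11Expr a b c x + 48 * w12Expr a b c x ^ 2) D := by
    fun_prop
  refine this.congr fun x hx => ?_
  rw [diagExpr, wPlus_zero_zero h hx, wPlus_zero_one h hx]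

/-- The discriminant of the model matrix of a Jacobi operator, in terms of the geometry. -/
lemma diagExpr_eq (h : SmoothWalker D a b c) (hx : x ∈ D) {τ ε : ℝ} (hε : ε = 1 ∨ ε = -1) :
    3 * (ε * (τ / 24)) * (ε * (w11Expr a b c x + τ / 12) / 4)
      - ε * w12Expr a b c x / 2 * -(ε * w12Expr a b c x / 4) = diagExpr a b c τ x / 384 := by
  rw [diagExpr, wPlus_zero_zero h hx, wPlus_zero_one h hx]
  rcases hε with rfl | rfl <;> ring

lemma ne_zero_of_eq_or {ε : ℝ} (hε : ε = 1 ∨ ε = -1) : ε ≠ 0 := by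
  rcases hε with rfl | rfl <;> norm_num

lemma isConj_jordan (h : SmoothWalker D a b c) (hx : x ∈ D) {τ : ℝ} (hτ : τ ≠ 0)
    (hE : EinsteinSelfDualAt a b c τ x) (hd : diagExpr a b c τ x ≠ 0) {ε : ℝ}
    (hε : ε = 1 ∨ ε = -1) {X : Fin 4 → ℝ} (hX : inner (walker a b c) x X X = ε) :
    IsConj (jacobi (walker a b c) x X) (modelJacobi (ε * (τ / 24)) 0 1 0) := by
  have hε0 := ne_zero_of_eq_or hε
  refine (isConj_modelJacobi h hx hE hε0 hX).trans (modelJacobi_isConj_jordan ?_ ?_)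
  · exact mul_ne_zero hε0 (div_ne_zero hτ (by norm_num))
  · rw [diagExpr_eq h hx hε]
    exact div_ne_zero hd (by norm_num)

lemma jacobi_of_scal_ne_zero (h : SmoothWalker D a b c) (hx : x ∈ D) {τ : ℝ} (hτ : τ ≠ 0)
    (hE : EinsteinSelfDualAt a b c τ x) {ε : ℝ} (hε : ε = 1 ∨ ε = -1) {X : Fin 4 → ℝ}
    (hX : inner (walker a b c) x X X = ε) :
    (jacobi (walker a b c) x X).charpoly = Polynomial.X *
      (Polynomial.X - Polynomial.C (ε * (τ / 6))) *
      (Polynomial.X - Polynomial.C (ε * (τ / 24))) ^ 2 ∧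
    (IsDiagonalizable (jacobi (walker a b c) x X) ↔ diagExpr a b c τ x = 0) ∧
    (diagExpr a b c τ x ≠ 0 →
      (minpoly ℝ (jacobi (walker a b c) x X)).rootMultiplicity (ε * (τ / 24)) = 2) := by
  have hε0 := ne_zero_of_eq_or hε
  have hc := isConj_modelJacobi h hx hE hε0 hX
  have ht : ε * (τ / 24) ≠ 0 := mul_ne_zero hε0 (div_ne_zero hτ (by norm_num))
  refine ⟨?_, ?_, fun hd => rootMultiplicity_minpoly_of_isConj ht
    (isConj_jordan h hx hτ hE hd hε hX)⟩
  · rw [charpoly_eq_of_isConj hc, modelJacobi_charpoly,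
      show 4 * (ε * (τ / 24)) = ε * (τ / 6) by ring]
  · rw [isDiagonalizable_of_isConj hc, modelJacobi_isDiagonalizable_iff ht, diagExpr_eq h hx hε]
    simp

/-- In the Ricci-flat case, `W⁺₁₂` is constant along the slices. -/
lemma w12Expr_of_formZero (h : SmoothWalker D a b c)
    (hQ : IsQuadratic D a b c (fun _ => 0) P Q S T U V ξ η γ) (hx : x ∈ D) :
    w12Expr a b c x =
      -(d3 T (proj x) + d3 U (proj x) - d4 P (proj x) - d4 V (proj x)) / 2 := by
  obtain ⟨hs, ⟨hP, hQ, hS, hT, hU, hV⟩, hξ, hη, hγ, ea, eb, ec⟩ := hQ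
  have c0 : ContDiffOn ℝ ∞ (0 : ℝ × ℝ → ℝ) (proj '' D) := contDiffOn_const
  have hs6 : ContDiffOn ℝ ∞ (fun _ : ℝ × ℝ => (0 : ℝ) / 6) (proj '' D) := contDiffOn_const
  obtain ⟨-, -, a00, a01, -, -, a03, -⟩ :=
    derivatives_of_eqOn_quad h.isOpen hs6 c0 c0 hP hQ hξ ea hx
  obtain ⟨-, -, -, b01, -, -, -, b12, -⟩ :=
    derivatives_of_eqOn_quad h.isOpen c0 c0 hs6 hS hT hη eb hx
  obtain ⟨-, -, c00, c01, c11, c02, -, -, c13⟩ :=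
    derivatives_of_eqOn_quad h.isOpen c0 hs6 c0 hU hV hγ ec hx
  have z3 : d3 (0 : ℝ × ℝ → ℝ) = 0 := d3_const 0
  have z4 : d4 (0 : ℝ × ℝ → ℝ) = 0 := d4_const 0
  rw [w12Expr, a00, a01, a03, b01, b12, c00, c01, c11, c02, c13]
  simp only [z3, z4, d3_const, d4_const, Pi.zero_apply]
  ring

lemma jacobi_of_scal_eq_zero (h : SmoothWalker D a b c) (hx : x ∈ D)
    (hE : EinsteinSelfDualAt a b c 0 x) {r : ℝ} (hr : w12Expr a b c x = -r / 2) {ε : ℝ}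
    (hε : ε = 1 ∨ ε = -1) {X : Fin 4 → ℝ} (hX : inner (walker a b c) x X X = ε) :
    (jacobi (walker a b c) x X).charpoly = Polynomial.X ^ 4 ∧
    (jacobi (walker a b c) x X = 0 ↔ (r = 0 ∧ wPlus a b c 0 0 x = 0)) ∧
    ((jacobi (walker a b c) x X ≠ 0 ∧ jacobi (walker a b c) x X ^ 2 = 0) ↔
      (r = 0 ∧ wPlus a b c 0 0 x ≠ 0)) ∧
    ((jacobi (walker a b c) x X ^ 2 ≠ 0 ∧ jacobi (walker a b c) x X ^ 3 = 0) ↔ r ≠ 0) := by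
  have hε0 := ne_zero_of_eq_or hε
  have hc := isConj_modelJacobi h hx hE hε0 hX
  rw [zero_div, mul_zero, zero_div, add_zero, ← wPlus_zero_zero h hx, hr] at hc
  have h1 : jacobi (walker a b c) x X = 0 ↔ (r = 0 ∧ wPlus a b c 0 0 x = 0) := by
    have := pow_eq_zero_iff_of_isConj hc 1
    rw [pow_one, pow_one, modelJacobi_zero_eq_zero_iff] at this
    rw [this]
    simp [hε0]
    tauto
  have h2 : jacobi (walker a b c) x X ^ 2 = 0 ↔ r = 0 := by
    rw [pow_eq_zero_iff_of_isConj hc 2, modelJacobi_zero_sq]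
    simp [hε0]
  have h3 : jacobi (walker a b c) x X ^ 3 = 0 :=
    (pow_eq_zero_iff_of_isConj hc 3).2 modelJacobi_zero_cube
  refine ⟨?_, h1, ?_, ?_⟩
  · rw [charpoly_eq_of_isConj hc, modelJacobi_charpoly]
    simp only [mul_zero, map_zero, sub_zero]
    ring
  · rw [Ne, h1, h2]
    tauto
  · rw [Ne, h2]
    tauto

end Walker

theorem mainTheorem3 (D : Set (Fin 4 → ℝ)) (hDopen : IsOpen D) (hDconn : IsConnected D)
    (hDslice : ∀ s t : ℝ, IsPreconnected {x | x ∈ D ∧ x 2 = s ∧ x 3 = t})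
    (a b c : (Fin 4 → ℝ) → ℝ)
    (ha : ContDiffOn ℝ ∞ a D) (hb : ContDiffOn ℝ ∞ b D) (hc : ContDiffOn ℝ ∞ c D) :
    -- the explicit expressions of the components of the self-dual Weyl tensor
    (∀ x ∈ D, Walker.wPlus a b c 0 0 x = Walker.w11Expr a b c x ∧
      Walker.wPlus a b c 0 1 x = Walker.w12Expr a b c x) ∧
    -- the characterization
    ((Walker.IsPointwiseOsserman (Walker.walker a b c) D ∧
        Walker.IsSelfDual (Walker.walker a b c) D) ↔
      ((∃ (τ : ℝ) (P Q S T U V : ℝ × ℝ → ℝ), Walker.FormNonzero D a b c τ P Q S T U V) ∨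
       (∃ P Q S T U V ξ η γ : ℝ × ℝ → ℝ, Walker.FormZero D a b c P Q S T U V ξ η γ))) ∧
    -- the Jacobi operators in case (i)
    (∀ (τ : ℝ) (P Q S T U V : ℝ × ℝ → ℝ), Walker.FormNonzero D a b c τ P Q S T U V →
      (∀ x ∈ D, ∀ ε : ℝ, (ε = 1 ∨ ε = -1) → ∀ X : Fin 4 → ℝ,
        Walker.inner (Walker.walker a b c) x X X = ε →
          (Walker.jacobi (Walker.walker a b c) x X).charpoly =
            Polynomial.X * (Polynomial.X - Polynomial.C (ε * (τ / 6))) *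
              (Polynomial.X - Polynomial.C (ε * (τ / 24))) ^ 2 ∧
          (Walker.IsDiagonalizable (Walker.jacobi (Walker.walker a b c) x X) ↔
            Walker.diagExpr a b c τ x = 0) ∧
          (Walker.diagExpr a b c τ x ≠ 0 →
            (minpoly ℝ (Walker.jacobi (Walker.walker a b c) x X)).rootMultiplicity
              (ε * (τ / 24)) = 2)) ∧
      IsOpen {x | x ∈ D ∧ Walker.diagExpr a b c τ x ≠ 0} ∧
      Walker.IsJordanOsserman (Walker.walker a b c)
        {x | x ∈ D ∧ Walker.diagExpr a b c τ x ≠ 0}) ∧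
    -- the Jacobi operators in case (ii)
    (∀ P Q S T U V ξ η γ : ℝ × ℝ → ℝ, Walker.FormZero D a b c P Q S T U V ξ η γ →
      ∀ x ∈ D, ∀ y : ℝ × ℝ, y = Walker.proj x → ∀ ε : ℝ, (ε = 1 ∨ ε = -1) → ∀ X : Fin 4 → ℝ,
        Walker.inner (Walker.walker a b c) x X X = ε →
          (Walker.jacobi (Walker.walker a b c) x X).charpoly = Polynomial.X ^ 4 ∧
          (Walker.jacobi (Walker.walker a b c) x X = 0 ↔
            (Walker.d3 T y + Walker.d3 U y - Walker.d4 P y - Walker.d4 V y = 0 ∧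
              Walker.wPlus a b c 0 0 x = 0)) ∧
          ((Walker.jacobi (Walker.walker a b c) x X ≠ 0 ∧
              Walker.jacobi (Walker.walker a b c) x X ^ 2 = 0) ↔
            (Walker.d3 T y + Walker.d3 U y - Walker.d4 P y - Walker.d4 V y = 0 ∧
              Walker.wPlus a b c 0 0 x ≠ 0)) ∧
          ((Walker.jacobi (Walker.walker a b c) x X ^ 2 ≠ 0 ∧
              Walker.jacobi (Walker.walker a b c) x X ^ 3 = 0) ↔
            Walker.d3 T y + Walker.d3 U y - Walker.d4 P y - Walker.d4 V y ≠ 0)) := by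
  have h : Walker.SmoothWalker D a b c := ⟨hDopen, ha, hb, hc⟩
  refine ⟨fun x hx => ⟨Walker.wPlus_zero_zero h hx, Walker.wPlus_zero_one h hx⟩,
    Walker.osserman_and_selfDual_iff h hDconn hDslice, fun τ P Q S T U V hF => ?_,
    fun P Q S T U V ξ η γ hF x hx y hy ε hε X hX => ?_⟩
  · obtain ⟨ξ, η, γ, hQ, hC⟩ := Walker.isQuadratic_of_formNonzero hDopen hF
    have hE := fun x hx => hQ.einsteinSelfDualAt h hx (hC (Walker.proj x))
    refine ⟨fun x hx ε hε X hX => Walker.jacobi_of_scal_ne_zero h hx hF.1 (hE x hx) hε hX, ?_, ?_⟩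
    · exact (Walker.continuousOn_diagExpr h τ).isOpen_inter_preimage hDopen isOpen_compl_singleton
    · rintro x ⟨hx, hxd⟩ y ⟨hy, hyd⟩ ε hε X Y hX hY
      exact (Walker.isConj_jordan h hx hF.1 (hE x hx) hxd hε hX).trans
        (isConj_comm.1 (Walker.isConj_jordan h hy hF.1 (hE y hy) hyd hε hY))
  · subst hy
    obtain ⟨hQ, hC⟩ := Walker.isQuadratic_of_formZero hF
    exact Walker.jacobi_of_scal_eq_zero h hx (hQ.einsteinSelfDualAt h hx (hC _ ⟨x, hx, rfl⟩))
      (Walker.w12Expr_of_formZero h hQ hx) hε hX
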